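/- Let $n,m\in\mathbb{N}^*$, $T>0$, $x^0\in\mathbb{R}^n$, let $\mathrm{U}\subset\mathbb{R}^m$ be nonempty, and let $f:\mathbb{R}^n\times\mathbb{R}^m\times[0,T]\to\mathbb{R}^n$, $(x,u,t)\mapsto f(x,u,t)$, be continuous and of class $\mathrm{C}^1$ with respect to $(x,u)$ (its differential with respect to $(x,u)$ exists and is continuous in $(x,u,t)$). A control $u\in\mathrm{L}^\infty([0,T],\mathbb{R}^m)$ is \emph{admissible} if there is an absolutely continuous $x_u:[0,T]\to\mathbb{R}^n$ (then unique) with $x_u(0)=x^0$ and $\dot x_u(t)=f(x_u(t),u(t),t)$ for a.e. $t\in[0,T]$. The set $\mathcal{U}$ of admissible controls is open in $\mathrm{L}^\infty([0,T],\mathbb{R}^m)$; let $\mathrm{E}:\mathcal{U}\to\mathbb{R}^n$, $\mathrm{E}(u)=x_u(T)$, be the end-point mapping and $\mathrm{D}\mathrm{E}(u)$ its Fréchet differential. For $A\subset\mathbb{R}^m$, $\mathrm{L}^\infty([0,T],A)$ is the set of controls with values in $A$ almost everywhere. A control $u\in\mathcal{U}$ is \emph{strongly regular} if $\mathrm{D}\mathrm{E}(u):\mathrm{L}^\infty([0,T],\mathbb{R}^m)\to\mathbb{R}^n$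 is surjective. If $\mathrm{U}$ is convex, $u\in\mathcal{U}\cap\mathrm{L}^\infty([0,T],\mathrm{U})$ is \emph{strongly $\mathrm{U}$-regular} if $\mathrm{D}\mathrm{E}(u)$ maps the tangent cone $\mathbb{R}_+(\mathrm{L}^\infty([0,T],\mathrm{U})-u)$ onto $\mathbb{R}^n$. A control $u\in\mathcal{U}\cap\mathrm{L}^\infty([0,T],\mathrm{U})$ is \emph{weakly $\mathrm{U}$-regular} if the smallest convex cone containing all vectors $w(T)$ is $\mathbb{R}^n$; here $\tau\in[0,T)$ ranges over the Lebesgue points of $t\mapsto f(x_u(t),u(t),t)$, $\omega$ ranges over $\mathrm{U}$, and $w$ is the absolutely continuous solution on $[\tau,T]$ of $\dot w(t)=\nabla_xf(x_u(t),u(t),t)\,w(t)$ for a.e. $t$, $w(\tau)=f(x_u(\tau),\omega,\tau)-f(x_u(\tau),u(\tau),\tau)$. (For every choice of a representative of $u$.) Let $u\in\mathcal{U}\cap\mathrm{L}^\infty([0,T],\mathrm{Int}(\mathrm{U}))$, where $\mathrm{Int}(\mathrm{U})$ is the interior of $\mathrm{U}$. (i) If $u$ is strongly regular, then $u$ is weakly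 $\mathrm{U}$-regular. The converse is not true in general: there are $n,m,T,x^0,f,\mathrm{U}$ and $u\in\mathcal{U}\cap\mathrm{L}^\infty([0,T],\mathrm{Int}(\mathrm{U}))$ as above such that $u$ is weakly $\mathrm{U}$-regular but not strongly regular. (ii) If $\mathrm{U}$ is convex, then $u$ is strongly regular if and only if $u$ is strongly $\mathrm{U}$-regular. -/

import Mathlib

open MeasureTheory Set Filter Topology
open scoped ENNReal

/-- A control system `x' = f (x, u, t)` on `[0, T]` with state space `ℝⁿ`, control space `ℝᵐ` and
starting point `x0`. The dynamics `f` is continuous on `ℝⁿ × ℝᵐ × [0, T]` and of class `C¹` with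
respect to its first two variables: its differential with respect to `(x, u)` exists and is
continuous on `ℝⁿ × ℝᵐ × [0, T]`. The values of `f` for `t` outside `[0, T]` play no role. -/
structure ControlSystem (n m : ℕ) where
  /-- The final time. -/
  T : ℝ
  T_pos : 0 < T
  /-- The dynamics. -/
  f : EuclideanSpace ℝ (Fin n) → EuclideanSpace ℝ (Fin m) → ℝ → EuclideanSpace ℝ (Fin n)
  /-- The starting point. -/
  x0 : EuclideanSpace ℝ (Fin n)
  continuousOn_f :
    ContinuousOn
      (fun q : EuclideanSpace ℝ (Fin n) × EuclideanSpace ℝ (Fin m) × ℝ => f q.1 q.2.1 q.2.2)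
      (univ ×ˢ univ ×ˢ Icc 0 T)
  differentiable_f : ∀ t ∈ Icc (0 : ℝ) T,
    Differentiable ℝ
      (fun p : EuclideanSpace ℝ (Fin n) × EuclideanSpace ℝ (Fin m) => f p.1 p.2 t)
  continuousOn_fderiv_f :
    ContinuousOn
      (fun q : EuclideanSpace ℝ (Fin n) × EuclideanSpace ℝ (Fin m) × ℝ =>
        fderiv ℝ (fun p : EuclideanSpace ℝ (Fin n) × EuclideanSpace ℝ (Fin m) => f p.1 p.2 q.2.2)
          (q.1, q.2.1))
      (univ ×ˢ univ ×ˢ Icc 0 T)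

/-- The point `τ` is a Lebesgue point of `g : [0, T] → F`. -/
def IsLebesguePoint {F : Type*} [NormedAddCommGroup F] (T : ℝ) (g : ℝ → F) (τ : ℝ) : Prop :=
  Tendsto (fun h : ℝ => h⁻¹ * ∫ s in Icc (τ - h) (τ + h) ∩ Icc 0 T, ‖g s - g τ‖)
    (𝓝[>] 0) (𝓝 0)

namespace ControlSystem

variable {n m : ℕ} (S : ControlSystem n m)

/-- The Banach space `L^∞([0, T], ℝᵐ)` of controls. -/
abbrev Control : Type :=
  Lp (EuclideanSpace ℝ (Fin m)) ∞ (volume.restrict (Icc (0 : ℝ) S.T))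

/-- The set `L^∞([0, T], A)` of controls with values in `A` almost everywhere. -/
def controlsIn (A : Set (EuclideanSpace ℝ (Fin m))) : Set S.Control :=
  {u | ∀ᵐ t ∂(volume.restrict (Icc (0 : ℝ) S.T)), u t ∈ A}

/-- `x` is absolutely continuous on `[0, T]`, starts at `x0`, and `x' = f (x, u, t)` almost
everywhere on `[0, T]`. -/
def IsTrajectory (u : S.Control) (x : ℝ → EuclideanSpace ℝ (Fin n)) : Prop :=
  AbsolutelyContinuousOnInterval x 0 S.T ∧ x 0 = S.x0 ∧
    ∀ᵐ t ∂(volume.restrict (Icc (0 : ℝ) S.T)), HasDerivAt x (S.f (x t) (u t) t) t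

/-- The control `u` is admissible. -/
def IsAdmissible (u : S.Control) : Prop :=
  ∃ x, S.IsTrajectory u x

open Classical in
/-- The trajectory `x_u` of an admissible control `u`. On `[0, T]` it is unique. -/
noncomputable def trajectory (u : S.Control) : ℝ → EuclideanSpace ℝ (Fin n) :=
  if h : S.IsAdmissible u then h.choose else 0

/-- The end-point mapping `E u = x_u(T)`. The admissible controls form an open subset of
`L^∞([0, T], ℝᵐ)`, so the values at other controls do not affect differentials at admissible
ones. -/
noncomputable def endPoint (u : S.Control) : EuclideanSpace ℝ (Fin n) :=
  S.trajectory u S.T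

/-- The (admissible) control `u` is strongly regular: the Fréchet differential of the end-point
mapping at `u` is surjective. -/
def IsStronglyRegular (u : S.Control) : Prop :=
  ∃ D : S.Control →L[ℝ] EuclideanSpace ℝ (Fin n),
    HasFDerivAt S.endPoint D u ∧ Function.Surjective D

/-- The tangent cone `ℝ₊ (L^∞([0, T], U) - u)`. -/
def tangentCone (U : Set (EuclideanSpace ℝ (Fin m))) (u : S.Control) : Set S.Control :=
  {v | ∃ r : ℝ, 0 ≤ r ∧ ∃ w ∈ S.controlsIn U, v = r • (w - u)}

/-- The (admissible) control `u` with values in the convex set `U` is strongly `U`-regular: the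
Fréchet differential of the end-point mapping at `u` maps the tangent cone onto `ℝⁿ`. -/
def IsStronglyURegular (U : Set (EuclideanSpace ℝ (Fin m))) (u : S.Control) : Prop :=
  ∃ D : S.Control →L[ℝ] EuclideanSpace ℝ (Fin n),
    HasFDerivAt S.endPoint D u ∧ D '' S.tangentCone U u = univ

/-- The strong `U`-variation vectors along `(x, v)`: the vectors `w(T)`, where `τ ∈ [0, T)` is a
Lebesgue point of `t ↦ f (x t, v t, t)`, `ω ∈ U`, and `w` is the absolutely continuous solution on
`[τ, T]` of `w' = ∇ₓf (x, v, t) w` with `w(τ) = f (x τ, ω, τ) - f (x τ, v τ, τ)`. -/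
def strongVariationVectors (U : Set (EuclideanSpace ℝ (Fin m)))
    (x : ℝ → EuclideanSpace ℝ (Fin n)) (v : ℝ → EuclideanSpace ℝ (Fin m)) :
    Set (EuclideanSpace ℝ (Fin n)) :=
  {z | ∃ τ ∈ Ico (0 : ℝ) S.T, IsLebesguePoint S.T (fun t => S.f (x t) (v t) t) τ ∧
    ∃ ω ∈ U, ∃ w : ℝ → EuclideanSpace ℝ (Fin n),
      AbsolutelyContinuousOnInterval w τ S.T ∧
      w τ = S.f (x τ) ω τ - S.f (x τ) (v τ) τ ∧
      (∀ᵐ t ∂(volume.restrict (Icc τ S.T)),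
        HasDerivAt w (fderiv ℝ (fun y => S.f y (v t) t) (x t) (w t)) t) ∧
      z = w S.T}

/-- The `U`-Pontryagin cone: the smallest convex cone (with apex `0`) containing all strong
`U`-variation vectors along `(x, v)`. -/
def pontryaginCone (U : Set (EuclideanSpace ℝ (Fin m)))
    (x : ℝ → EuclideanSpace ℝ (Fin n)) (v : ℝ → EuclideanSpace ℝ (Fin m)) :
    PointedCone ℝ (EuclideanSpace ℝ (Fin n)) :=
  PointedCone.hull ℝ (S.strongVariationVectors U x v)

/-- The (admissible) control `u` with values in `U` is weakly `U`-regular: its `U`-Pontryagin cone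
is `ℝⁿ`. Since Lebesgue points and values at them refer to a function rather than to an almost
everywhere class, this is required for every representative `v` of `u`. -/
def IsWeaklyURegular (U : Set (EuclideanSpace ℝ (Fin m))) (u : S.Control) : Prop :=
  ∀ v : ℝ → EuclideanSpace ℝ (Fin m), v =ᵐ[volume.restrict (Icc (0 : ℝ) S.T)] u →
    (S.pontryaginCone U (S.trajectory u) v : Set (EuclideanSpace ℝ (Fin n))) = univ

end ControlSystem

/-! Along a trajectory, linearize `w' = A w` with fundamental solution `Φ` and inverse `Ψ`.
Variation of constants gives `DE(u) w = ∫ K(t) w(t) dt` with `K(t) = Φ(T) Ψ(t) ∂ᵤf`. Hence, if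
`DE(u)` is onto, no nonzero functional `ψ` satisfies `ψ K = 0` almost everywhere
(`fderiv_endPoint_apply`, `eq_zero_of_comp_kernel_ae_eq_zero`).

A convex cone other than `ℝⁿ` has a nonzero functional `ψ` that is nonnegative on it
(`exists_clm_nonneg_of_pointedCone_ne_univ`), so it suffices to derive `ψ K = 0` a.e. from that
sign. For the Pontryagin cone, nonnegativity says that `ω ↦ ψ (Φ(T) Ψ(τ) f(x, ω, τ))` is minimal
over `U` at `u(τ)` for a.e. `τ`; as `u(τ)` is interior, the derivative `ψ K(τ)` vanishes. For the
image of the tangent cone, test with a small positive multiple, depending on `t`, of minus the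
gradient of `ψ K(t)`: the integral of a nonpositive function is then nonnegative, so `ψ K` vanishes
a.e. The other half of (ii) holds because the tangent cone is part of the whole space.

The converse of (i) fails for `x' = u³` at `u = 0`: the linearization is zero, while needle
variations reach every value through the cube. -/

/-! ### Analytic tools: bounded integrands, integral equations, Lebesgue points, cones. -/

section Tools

variable {E X Y : Type*} [NormedAddCommGroup E] [NormedSpace ℝ E]
  [NormedAddCommGroup X] [NormedAddCommGroup Y]

/-- Strongly measurable and bounded on bounded intervals. -/
structure IsLocBdd (h : ℝ → X) : Prop where
  stronglyMeasurable : StronglyMeasurable h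
  bound : ∀ a b : ℝ, ∃ C, ∀ t ∈ Icc a b, ‖h t‖ ≤ C

namespace IsLocBdd

theorem of_continuous {h : ℝ → X} (hh : Continuous h) : IsLocBdd h :=
  ⟨hh.stronglyMeasurable, fun _ _ => isCompact_Icc.exists_bound_of_continuousOn hh.continuousOn⟩

theorem of_bound {h : ℝ → X} (hm : StronglyMeasurable h) {C : ℝ} (hC : ∀ t, ‖h t‖ ≤ C) :
    IsLocBdd h :=
  ⟨hm, fun _ _ => ⟨C, fun t _ => hC t⟩⟩

theorem prodMk {h : ℝ → X} {k : ℝ → Y} (hh : IsLocBdd h) (hk : IsLocBdd k) :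
    IsLocBdd (fun t => (h t, k t)) := by
  refine ⟨hh.1.prodMk hk.1, fun a b => ?_⟩
  obtain ⟨C, hC⟩ := hh.2 a b
  obtain ⟨C', hC'⟩ := hk.2 a b
  exact ⟨max C C', fun t ht => max_le_max (hC t ht) (hC' t ht)⟩

/-- Continuous maps are bounded on the compact balls of a proper space. Together with `prodMk` this
yields integrability of the integrands below, written as a continuous `G` of a tuple. -/
theorem comp [ProperSpace X] {h : ℝ → X} (hh : IsLocBdd h) {G : X → Y} (hG : Continuous G) :
    IsLocBdd (fun t => G (h t)) := by
  refine ⟨hG.comp_stronglyMeasurable hh.1, fun a b => ?_⟩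
  obtain ⟨C, hC⟩ := hh.2 a b
  obtain ⟨C', hC'⟩ := (isCompact_closedBall (0 : X) C).exists_bound_of_continuousOn
    hG.continuousOn
  exact ⟨C', fun t ht => hC' _ (by simpa using hC t ht)⟩

theorem intervalIntegrable {h : ℝ → X} (hh : IsLocBdd h) (a b : ℝ) :
    IntervalIntegrable h volume a b := by
  obtain ⟨C, hC⟩ := hh.2 (min a b) (max a b)
  rw [intervalIntegrable_iff]
  refine Measure.integrableOn_of_bounded (M := C) (by simp [uIoc]) hh.1.aestronglyMeasurable ?_
  filter_upwards [ae_restrict_mem measurableSet_uIoc] with t ht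
  exact hC t ⟨ht.1.le, ht.2⟩

theorem continuous_integral [NormedSpace ℝ X] {h : ℝ → X} (hh : IsLocBdd h) (a : ℝ) :
    Continuous (fun t => ∫ s in a..t, h s) :=
  intervalIntegral.continuous_primitive hh.intervalIntegrable a

theorem lipschitzOnWith_integral [NormedSpace ℝ X] {h : ℝ → X} (hh : IsLocBdd h) (T : ℝ) :
    ∃ C, LipschitzOnWith C (fun t => ∫ s in (0 : ℝ)..t, h s) (Icc 0 T) := by
  obtain ⟨C, hC⟩ := hh.2 0 T
  refine ⟨C.toNNReal, LipschitzOnWith.of_dist_le_mul fun a ha b hb => ?_⟩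
  rw [dist_eq_norm, intervalIntegral.integral_interval_sub_left (hh.intervalIntegrable _ _)
    (hh.intervalIntegrable _ _), Real.dist_eq]
  refine intervalIntegral.norm_integral_le_of_norm_le_const fun t ht => ?_
  refine (hC t ?_).trans (Real.le_coe_toNNReal C)
  exact (uIcc_subset_Icc hb ha) (uIoc_subset_uIcc ht)

theorem ae_hasDerivAt_integral [NormedSpace ℝ X] [CompleteSpace X] {h : ℝ → X} (hh : IsLocBdd h) (T : ℝ) :
    ∀ᵐ t ∂(volume.restrict (Icc (0 : ℝ) T)), HasDerivAt (fun t => ∫ s in (0 : ℝ)..t, h s) (h t) t := by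
  rw [ae_restrict_iff' measurableSet_Icc]
  filter_upwards [(hh.intervalIntegrable 0 T).ae_hasDerivAt_integral] with t ht h't
  have : uIcc 0 T = Icc 0 T := uIcc_of_le (h't.1.trans h't.2)
  rw [this] at ht
  exact ht h't 0 ⟨le_rfl, h't.1.trans h't.2⟩

end IsLocBdd

/-- Fundamental theorem of calculus for absolutely continuous functions whose derivative is
bounded. -/
theorem AbsolutelyContinuousOnInterval.eq_add_integral [NormedSpace ℝ X] [CompleteSpace X] {x h : ℝ → X} {T : ℝ}
    (hx : AbsolutelyContinuousOnInterval x 0 T) (hh : IsLocBdd h)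
    (hd : ∀ᵐ t ∂(volume.restrict (Icc (0 : ℝ) T)), HasDerivAt x (h t) t) {t : ℝ}
    (ht : t ∈ Icc 0 T) : x t = x 0 + ∫ s in (0 : ℝ)..t, h s := by
  have hT : (0 : ℝ) ≤ T := ht.1.trans ht.2
  obtain ⟨C, hC⟩ := hh.lipschitzOnWith_integral T
  rw [← uIcc_of_le hT] at hC
  have hg := hx.sub hC.absolutelyContinuousOnInterval
  have h0 : ∀ᵐ t, t ∈ uIcc 0 T → HasDerivAt (x - fun t => ∫ s in (0 : ℝ)..t, h s) 0 t := by
    rw [uIcc_of_le hT, ← ae_restrict_iff' measurableSet_Icc]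
    filter_upwards [hd, hh.ae_hasDerivAt_integral T] with t h1 h2
    simpa using h1.sub h2
  obtain ⟨c, hc⟩ := hg.const_of_ae_hasDerivAt_zero h0
  have e1 := hc t (by rwa [uIcc_of_le hT])
  have e0 := hc 0 (by simp)
  simp only [Pi.sub_apply, intervalIntegral.integral_same, sub_zero] at e1 e0
  rw [e0, ← e1]; abel

/-- Grönwall's inequality in integral form. -/
theorem le_mul_exp_of_le_add_integral {φ : ℝ → ℝ} (hφ : Continuous φ) {a K T : ℝ} (hK : 0 ≤ K)
    (h : ∀ t ∈ Icc 0 T, φ t ≤ a + K * ∫ s in (0 : ℝ)..t, φ s) {t : ℝ} (ht : t ∈ Icc 0 T) :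
    φ t ≤ a * Real.exp (K * t) := by
  -- The comparison is made for the right-hand side, which is differentiable although `φ` need not
  -- be.
  have hd : ∀ t, HasDerivAt (fun t => a + K * ∫ s in (0 : ℝ)..t, φ s) (K * φ t) t := fun t =>
    ((intervalIntegral.integral_hasDerivAt_right (hφ.intervalIntegrable _ _)
      (hφ.stronglyMeasurableAtFilter _ _) hφ.continuousAt).const_mul K).const_add a
  have := le_gronwallBound_of_liminf_deriv_right_le
    (f := fun t => a + K * ∫ s in (0 : ℝ)..t, φ s) (f' := fun t => K * φ t) (δ := a) (K := K)
    (ε := 0) (a := 0) (b := T) (fun t _ => (hd t).continuousAt.continuousWithinAt)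
    (fun t _ r hr => (hd t).hasDerivWithinAt.liminf_right_slope_le hr) (by simp)
    (fun t ht => by
      have := mul_le_mul_of_nonneg_left (h t ⟨ht.1, ht.2.le⟩) hK
      linarith) t ht
  rw [gronwallBound_ε0, sub_zero] at this
  exact (h t ht).trans this

/-- Global existence for Carathéodory differential equations with Lipschitz right-hand side. -/
theorem exists_eq_add_integral_of_lipschitz [CompleteSpace E] {T : ℝ} (hT : 0 ≤ T)
    {g : ℝ → E → E} {K : ℝ} (hK : 0 ≤ K)
    (hg : ∀ t ∈ Icc 0 T, ∀ y z, ‖g t y - g t z‖ ≤ K * ‖y - z‖)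
    (hi : ∀ x : ℝ → E, Continuous x → IsLocBdd (fun t => g t (x t))) (x0 : E) :
    ∃ x : ℝ → E, Continuous x ∧ ∀ t ∈ Icc 0 T, x t = x0 + ∫ s in (0 : ℝ)..t, g s (x s) := by
  let ext : C(Icc 0 T, E) → ℝ → E := fun x => IccExtend hT x
  have hext : ∀ x, Continuous (ext x) := fun x => x.continuous.Icc_extend'
  let P : C(Icc 0 T, E) → C(Icc 0 T, E) := fun x =>
    ⟨fun t => x0 + ∫ s in (0 : ℝ)..t, g s (ext x s),
      (continuous_const.add ((hi _ (hext x)).continuous_integral 0)).comp continuous_subtype_val⟩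
  -- The factorial decay makes some iterate of the Picard map `P` a contraction for any `T`; its
  -- fixed point is then fixed by `P` itself.
  have key : ∀ (n : ℕ) (x y : C(Icc 0 T, E)) (t : Icc 0 T),
      ‖P^[n] x t - P^[n] y t‖ ≤ (K * t) ^ n / n.factorial * dist x y := by
    intro n x y
    induction n with
    | zero =>
      intro t
      simpa [dist_eq_norm] using ContinuousMap.dist_apply_le_dist (f := x) (g := y) t
    | succ n ih =>
      intro t
      rw [Function.iterate_succ_apply', Function.iterate_succ_apply']
      set x' := P^[n] x
      set y' := P^[n] y
      change ‖(x0 + ∫ s in (0 : ℝ)..t, g s (ext x' s)) - (x0 + ∫ s in (0 : ℝ)..t, g s (ext y' s))‖ ≤ _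
      rw [add_sub_add_left_eq_sub, ← intervalIntegral.integral_sub
        ((hi _ (hext x')).intervalIntegrable _ _) ((hi _ (hext y')).intervalIntegrable _ _)]
      have hb : ∀ s ∈ Icc (0 : ℝ) t, ‖g s (ext x' s) - g s (ext y' s)‖ ≤
          K * ((K * s) ^ n / n.factorial * dist x y) := by
        intro s hs
        have hsT : s ∈ Icc 0 T := ⟨hs.1, hs.2.trans t.2.2⟩
        refine (hg s hsT _ _).trans (mul_le_mul_of_nonneg_left ?_ hK)
        have := ih ⟨s, hsT⟩
        simpa only [ext, IccExtend_of_mem hT _ hsT] using this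
      calc _ ≤ ∫ s in (0 : ℝ)..t, K * ((K * s) ^ n / n.factorial * dist x y) :=
            intervalIntegral.norm_integral_le_of_norm_le t.2.1
              (Eventually.of_forall fun s hs => hb s ⟨hs.1.le, hs.2⟩)
              (Continuous.intervalIntegrable (by fun_prop) _ _)
        _ = _ := by
            have : (fun s : ℝ => K * ((K * s) ^ n / n.factorial * dist x y)) =
                fun s => (K ^ (n + 1) / n.factorial * dist x y) * s ^ n := by
              ext s; rw [mul_pow]; ring
            rw [this, intervalIntegral.integral_const_mul, integral_pow, Nat.factorial_succ]
            push_cast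
            rw [mul_pow]
            field_simp
            simp
  obtain ⟨n, hn⟩ := (FloorSemiring.tendsto_pow_div_factorial_atTop (K * T)
    |>.eventually (gt_mem_nhds zero_lt_one)).exists
  have hc0 : 0 ≤ (K * T) ^ n / n.factorial := by positivity
  have hc : ContractingWith (Real.toNNReal ((K * T) ^ n / n.factorial)) P^[n] := by
    refine ⟨Real.toNNReal_lt_one.2 hn, LipschitzWith.of_dist_le_mul fun x y => ?_⟩
    rw [Real.coe_toNNReal _ hc0]
    refine (ContinuousMap.dist_le (by positivity)).2 fun t => ?_
    rw [dist_eq_norm]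
    refine (key n x y t).trans ?_
    have h1 := t.2.1
    have h2 := t.2.2
    gcongr
  have hfix := hc.isFixedPt_fixedPoint_iterate
  set x := ContractingWith.fixedPoint P^[n] hc
  refine ⟨ext x, hext x, fun t ht => ?_⟩
  have := congrArg (fun z : C(Icc 0 T, E) => z ⟨t, ht⟩) hfix
  simp only [ext, IccExtend_of_mem hT _ ht]
  exact this.symm

/-- A Lipschitz retraction with bounded range which is the identity on a given ball. -/
theorem exists_lipschitz_bounded_retraction (E : Type*) [NormedAddCommGroup E] [NormedSpace ℝ E]
    [FiniteDimensional ℝ E] (R : ℝ) :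
    ∃ (ρ : E → E) (K C : ℝ), 0 ≤ K ∧ (∀ y z, ‖ρ y - ρ z‖ ≤ K * ‖y - z‖) ∧ (∀ y, ‖ρ y‖ ≤ C) ∧
      ∀ y, ‖y‖ ≤ R → ρ y = y := by
  -- The retraction truncates coordinates to `[-c, c]`; `c` bounds every coordinate of a vector of
  -- norm at most `R`.
  let e : E ≃L[ℝ] (Fin (Module.finrank ℝ E) → ℝ) :=
    (Module.finBasis ℝ E).equivFunL
  let c : ℝ := ‖(e : E →L[ℝ] (Fin (Module.finrank ℝ E) → ℝ))‖ * |R|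
  let c' : ℝ := ‖(e.symm : (Fin (Module.finrank ℝ E) → ℝ) →L[ℝ] E)‖
  have hc : 0 ≤ c := by positivity
  have hle : ∀ z, ‖e.symm z‖ ≤ c' * ‖z‖ := fun z =>
    (e.symm : (Fin (Module.finrank ℝ E) → ℝ) →L[ℝ] E).le_opNorm z
  have hle' : ∀ z, ‖e z‖ ≤ ‖(e : E →L[ℝ] (Fin (Module.finrank ℝ E) → ℝ))‖ * ‖z‖ := fun z =>
    (e : E →L[ℝ] (Fin (Module.finrank ℝ E) → ℝ)).le_opNorm z
  refine ⟨fun y => e.symm fun i => max (-c) (min c (e y i)),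
    c' * ‖(e : E →L[ℝ] (Fin (Module.finrank ℝ E) → ℝ))‖, c' * c, by positivity, ?_, ?_, ?_⟩
  · intro y z
    rw [← map_sub, mul_assoc]
    refine (hle _).trans (mul_le_mul_of_nonneg_left (le_trans ?_ (hle' _)) (norm_nonneg _))
    refine (pi_norm_le_iff_of_nonneg (norm_nonneg _)).2 fun i => ?_
    refine le_trans ?_ (norm_le_pi_norm _ i)
    simp only [Pi.sub_apply, map_sub, Real.norm_eq_abs]
    refine (abs_max_sub_max_le_max _ _ _ _).trans ?_
    rw [sub_self, abs_zero]
    refine max_le (abs_nonneg _) ((abs_min_sub_min_le_max _ _ _ _).trans ?_)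
    simp
  · intro y
    refine (hle _).trans (mul_le_mul_of_nonneg_left ?_ (norm_nonneg _))
    refine (pi_norm_le_iff_of_nonneg hc).2 fun i => ?_
    rw [Real.norm_eq_abs, abs_le]
    exact ⟨le_max_left _ _, max_le (by linarith) (min_le_left _ _)⟩
  · intro y hy
    have : (fun i => max (-c) (min c (e y i))) = e y := by
      ext i
      have h1 : |e y i| ≤ c := (norm_le_pi_norm (e y) i).trans ((hle' y).trans
        (mul_le_mul_of_nonneg_left (hy.trans (le_abs_self R)) (norm_nonneg _)))
      rw [abs_le] at h1
      rw [min_eq_right h1.2, max_eq_right h1.1]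
    simp only [this]
    simp

/-- Almost every point is a Lebesgue point. -/
theorem ae_isLebesguePoint {T : ℝ} {g : ℝ → X} (hg : IntegrableOn g (Icc 0 T)) :
    ∀ᵐ τ ∂(volume.restrict (Icc (0 : ℝ) T)), IsLebesguePoint T g τ := by
  have hi : Integrable (indicator (Icc 0 T) g) := hg.integrable_indicator measurableSet_Icc
  have h0 : ∀ᵐ t : ℝ, t ≠ 0 := by simp [ae_iff, measure_singleton]
  have hT : ∀ᵐ t : ℝ, t ≠ T := by simp [ae_iff, measure_singleton]
  rw [ae_restrict_iff' measurableSet_Icc]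
  filter_upwards [IsUnifLocDoublingMeasure.ae_tendsto_average_norm_sub volume
    hi.locallyIntegrable 1, h0, hT] with τ hτ h0 hT hmem
  have hlt : τ ∈ Ioo 0 T := ⟨lt_of_le_of_ne hmem.1 h0.symm, lt_of_le_of_ne hmem.2 hT⟩
  have h1 := hτ (l := 𝓝[>] (0 : ℝ)) (fun _ => τ) id tendsto_id
    (by filter_upwards [self_mem_nhdsWithin] with h hh
        simp only [id, one_mul]; exact Metric.mem_closedBall_self (le_of_lt hh))
  -- The average divides by the length `2h` of the window, `IsLebesguePoint` only by `h`.
  have h2 := h1.const_mul 2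
  rw [mul_zero] at h2
  refine h2.congr' ?_
  have hε : ∀ᶠ h in 𝓝[>] (0 : ℝ), h < min τ (T - τ) :=
    (gt_mem_nhds (lt_min hlt.1 (by linarith [hlt.2]))).filter_mono nhdsWithin_le_nhds
  filter_upwards [self_mem_nhdsWithin, hε] with h hh hlt'
  have hh : 0 < h := hh
  have e1 : Metric.closedBall τ h = Icc (τ - h) (τ + h) := Real.closedBall_eq_Icc
  have hsub : Icc (τ - h) (τ + h) ⊆ Icc 0 T := by
    have := lt_min_iff.1 hlt'
    exact Icc_subset_Icc (by linarith) (by linarith)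
  rw [setAverage_eq, id, e1, inter_eq_left.2 hsub, smul_eq_mul]
  have e2 : ∫ s in Icc (τ - h) (τ + h), ‖indicator (Icc 0 T) g s - indicator (Icc 0 T) g τ‖ =
      ∫ s in Icc (τ - h) (τ + h), ‖g s - g τ‖ := by
    refine setIntegral_congr_fun measurableSet_Icc fun s hs => ?_
    simp only [indicator_of_mem (hsub hs), indicator_of_mem hmem]
  rw [e2, Measure.real, Real.volume_Icc, ENNReal.toReal_ofReal (by linarith)]
  have : τ + h - (τ - h) = 2 * h := by ring
  rw [this, mul_inv]
  ring

/-- A convex cone of a finite-dimensional space that is not the whole space lies in a half-space. -/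
theorem exists_clm_nonneg_of_pointedCone_ne_univ [FiniteDimensional ℝ E] {C : PointedCone ℝ E}
    (hC : (C : Set E) ≠ univ) : ∃ ψ : E →L[ℝ] ℝ, ψ ≠ 0 ∧ ∀ z ∈ C, 0 ≤ ψ z := by
  have hconv : Convex ℝ (C : Set E) := PointedCone.convex C
  by_cases hint : (interior (C : Set E)).Nonempty
  · obtain ⟨z, hz⟩ := (ne_univ_iff_exists_notMem _).1 hC
    obtain ⟨a, ha⟩ := hint
    have hz' : z ∉ interior (C : Set E) := fun h => hz (interior_subset h)
    obtain ⟨f, hf⟩ := geometric_hahn_banach_open_point hconv.interior isOpen_interior hz'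
    have hle : ∀ y ∈ C, f y ≤ f z := by
      intro y hy
      have : y ∈ closure (interior (C : Set E)) := by
        rw [hconv.closure_interior_eq_closure_of_nonempty_interior ⟨a, ha⟩]
        exact subset_closure hy
      exact closure_minimal (t := {y | f y ≤ f z}) (fun y hy => (hf y hy).le)
        (isClosed_le f.continuous continuous_const) this
    refine ⟨-f, ?_, fun y hy => ?_⟩
    · intro h
      have h' : f = 0 := by simpa using h
      simpa [h'] using hf a ha
    · simp only [neg_apply, Left.nonneg_neg_iff]
      by_contra! hpos
      -- On a cone, a functional bounded above is nonpositive: this multiple of `y` has value `|f z|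
      -- + 1 > f z`.
      have := hle (((|f z| + 1) / f y) • y) (C.smul_mem (by positivity : 0 ≤ (|f z| + 1) / f y) hy)
      rw [map_smul, smul_eq_mul, div_mul_cancel₀ _ hpos.ne'] at this
      linarith [le_abs_self (f z)]
  -- With empty interior the cone spans a proper subspace, and a functional vanishing there will do.
  · rw [hconv.interior_nonempty_iff_affineSpan_eq_top] at hint
    have hspan : Submodule.span ℝ (C : Set E) ≠ ⊤ := by
      intro h
      apply hint
      rw [AffineSubspace.affineSpan_eq_top_iff_vectorSpan_eq_top_of_nonempty ℝ E E
        ⟨0, zero_mem C⟩, eq_top_iff, ← h]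
      refine Submodule.span_le.2 fun z hz => ?_
      simpa using vsub_mem_vectorSpan ℝ hz (zero_mem C)
    obtain ⟨f, hf, hf'⟩ := Submodule.exists_le_ker_of_lt_top _ (lt_top_iff_ne_top.2 hspan)
    refine ⟨LinearMap.toContinuousLinearMap f, by simpa using hf, fun z hz => ?_⟩
    exact (show f z = 0 from hf' (Submodule.subset_span hz)).ge

end Tools

/-! ### Perturbation and linearization of Carathéodory differential equations. -/

section Dynamics

variable {E V X : Type*} [NormedAddCommGroup E] [NormedSpace ℝ E]
  [NormedAddCommGroup V] [NormedSpace ℝ V] [NormedAddCommGroup X] [NormedSpace ℝ X]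

/-- Lipschitz solutions of a Carathéodory differential equation with Lipschitz right-hand side. -/
theorem exists_lipschitzOnWith_hasDerivAt [CompleteSpace E] {T : ℝ} (hT : 0 ≤ T)
    {g : ℝ → E → E} {K : ℝ} (hK : 0 ≤ K)
    (hg : ∀ t ∈ Icc 0 T, ∀ y z, ‖g t y - g t z‖ ≤ K * ‖y - z‖)
    (hi : ∀ x : ℝ → E, Continuous x → IsLocBdd (fun t => g t (x t))) (x0 : E) :
    ∃ x : ℝ → E, Continuous x ∧ x 0 = x0 ∧ (∃ C, LipschitzOnWith C x (Icc 0 T)) ∧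
      ∀ᵐ t ∂(volume.restrict (Icc (0 : ℝ) T)), HasDerivAt x (g t (x t)) t := by
  obtain ⟨x, hx, hxe⟩ := exists_eq_add_integral_of_lipschitz hT hK hg hi x0
  have hb := hi x hx
  -- The integral replaces `x`, which agrees with it only on `[0, T]`; its two-sided a.e. derivative
  -- comes from the differentiation theorem.
  refine ⟨fun t => x0 + ∫ s in (0 : ℝ)..t, g s (x s),
    continuous_const.add (hb.continuous_integral 0), by simp, ?_, ?_⟩
  · obtain ⟨C, hC⟩ := hb.lipschitzOnWith_integral T
    exact ⟨C, LipschitzOnWith.of_dist_le_mul fun a ha b hb => by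
      simpa using hC.dist_le_mul a ha b hb⟩
  · filter_upwards [hb.ae_hasDerivAt_integral T, ae_restrict_mem measurableSet_Icc] with t h1 h2
    rw [← hxe t h2]
    exact h1.const_add x0

/-- Grönwall with a source term: `c = 0` gives uniqueness, `c` proportional to `|s|` gives linear
dependence on the perturbation. -/
theorem norm_le_of_eq_integral {z h : ℝ → E} (hz : Continuous z) {T K c : ℝ} (hK : 0 ≤ K)
    (hc : 0 ≤ c) (hzh : ∀ t ∈ Icc 0 T, z t = ∫ s in (0 : ℝ)..t, h s)
    (hb : ∀ t ∈ Icc 0 T, ‖h t‖ ≤ K * ‖z t‖ + c) {t : ℝ} (ht : t ∈ Icc 0 T) :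
    ‖z t‖ ≤ c * T * Real.exp (K * T) := by
  have h1 : ∀ t ∈ Icc 0 T, ‖z t‖ ≤ c * T + K * ∫ s in (0 : ℝ)..t, ‖z s‖ := by
    intro t ht
    rw [hzh t ht]
    calc _ ≤ ∫ s in (0 : ℝ)..t, (K * ‖z s‖ + c) :=
          intervalIntegral.norm_integral_le_of_norm_le ht.1
            (Eventually.of_forall fun s hs => hb s ⟨hs.1.le, hs.2.trans ht.2⟩)
            (Continuous.intervalIntegrable (by fun_prop) _ _)
      _ = K * (∫ s in (0 : ℝ)..t, ‖z s‖) + c * t := by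
          rw [intervalIntegral.integral_add (Continuous.intervalIntegrable (by fun_prop) _ _)
            (by simp), intervalIntegral.integral_const_mul]
          simp [mul_comm]
      _ ≤ _ := by
          have := mul_le_mul_of_nonneg_left ht.2 hc
          linarith
  have hT : 0 ≤ T := ht.1.trans ht.2
  refine (le_mul_exp_of_le_add_integral hz.norm hK h1 ht).trans ?_
  have := ht.2
  gcongr

/-- Keeps products absolutely continuous, so that they are determined by their a.e. derivatives. -/
theorem LipschitzOnWith.clm_apply {Φ : ℝ → E →L[ℝ] X} {z : ℝ → E} {T : ℝ}
    (hΦ : ∃ C, LipschitzOnWith C Φ (Icc 0 T)) (hz : ∃ C, LipschitzOnWith C z (Icc 0 T)) :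
    ∃ C, LipschitzOnWith C (fun t => Φ t (z t)) (Icc 0 T) := by
  obtain ⟨C, hC⟩ := hΦ
  obtain ⟨D, hD⟩ := hz
  obtain ⟨c, hc⟩ := isCompact_Icc.exists_bound_of_continuousOn hC.continuousOn
  obtain ⟨d, hd⟩ := isCompact_Icc.exists_bound_of_continuousOn hD.continuousOn
  refine ⟨(c * D + C * d).toNNReal, LipschitzOnWith.of_dist_le_mul fun a ha b hb => ?_⟩
  have h1 := hC.dist_le_mul a ha b hb
  have h2 := hD.dist_le_mul a ha b hb
  rw [dist_eq_norm] at h1 h2 ⊢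
  have e : Φ a (z a) - Φ b (z b) = Φ a (z a - z b) + (Φ a - Φ b) (z b) := by
    simp
  have hc0 : 0 ≤ c := (norm_nonneg _).trans (hc a ha)
  calc _ ≤ ‖Φ a‖ * ‖z a - z b‖ + ‖Φ a - Φ b‖ * ‖z b‖ := by
        rw [e]
        exact (norm_add_le _ _).trans (add_le_add (ContinuousLinearMap.le_opNorm _ _)
          (ContinuousLinearMap.le_opNorm _ _))
    _ ≤ c * (D * dist a b) + (C * dist a b) * d := by
        have := hc a ha
        have := hd b hb
        gcongr
    _ = (c * D + C * d) * dist a b := by ring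
    _ ≤ _ := mul_le_mul_of_nonneg_right (Real.le_coe_toNNReal _) dist_nonneg

/-- `Φ` is the fundamental solution of `w' = A w` on `[0, T]`, with inverse `Ψ`. -/
structure IsResolvent (A : ℝ → E →L[ℝ] E) (T : ℝ) (Φ Ψ : ℝ → E →L[ℝ] E) : Prop where
  continuous_left : Continuous Φ
  continuous_right : Continuous Ψ
  lipschitz_left : ∃ C, LipschitzOnWith C Φ (Icc 0 T)
  lipschitz_right : ∃ C, LipschitzOnWith C Ψ (Icc 0 T)
  left_mul_right : ∀ t ∈ Icc 0 T, Φ t * Ψ t = 1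
  hasDerivAt_left : ∀ᵐ t ∂(volume.restrict (Icc (0 : ℝ) T)), HasDerivAt Φ (A t * Φ t) t
  hasDerivAt_right : ∀ᵐ t ∂(volume.restrict (Icc (0 : ℝ) T)), HasDerivAt Ψ (-(Ψ t * A t)) t

/-- `Φ` and `Ψ` solve separate linear equations, chosen so that `Ψ Φ` has zero derivative a.e. and
hence stays equal to its initial value `1`. -/
theorem exists_isResolvent [FiniteDimensional ℝ E] {A : ℝ → E →L[ℝ] E} (hA : IsLocBdd A) {T : ℝ}
    (hT : 0 ≤ T) : ∃ Φ Ψ, IsResolvent A T Φ Ψ := by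
  have := FiniteDimensional.complete ℝ E
  obtain ⟨K, hK⟩ := hA.2 0 T
  have hK0 : 0 ≤ K := (norm_nonneg _).trans (hK 0 ⟨le_rfl, hT⟩)
  obtain ⟨Φ, hΦ, hΦ0, hΦl, hΦd⟩ := exists_lipschitzOnWith_hasDerivAt hT hK0
    (g := fun t (Y : E →L[ℝ] E) => A t * Y)
    (fun t ht y z => by
      rw [← mul_sub]
      exact (norm_mul_le _ _).trans (mul_le_mul_of_nonneg_right (hK t ht) (norm_nonneg _)))
    (fun x hx => (hA.prodMk (IsLocBdd.of_continuous hx)).comp (G := fun p => p.1 * p.2)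
      (by fun_prop)) 1
  obtain ⟨Ψ, hΨ, hΨ0, hΨl, hΨd⟩ := exists_lipschitzOnWith_hasDerivAt hT hK0
    (g := fun t (Y : E →L[ℝ] E) => -(Y * A t))
    (fun t ht y z => by
      rw [← neg_sub', ← sub_mul, norm_neg, mul_comm K]
      exact (norm_mul_le _ _).trans (mul_le_mul_of_nonneg_left (hK t ht) (norm_nonneg _)))
    (fun x hx => (hA.prodMk (IsLocBdd.of_continuous hx)).comp (G := fun p => -(p.2 * p.1))
      (by fun_prop)) 1
  have hmul : ∀ t ∈ Icc 0 T, Ψ t * Φ t = 1 := by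
    obtain ⟨C, hC⟩ := hΨl
    have hl : ∃ C, LipschitzOnWith C
        (fun t => ContinuousLinearMap.mul ℝ (E →L[ℝ] E) (Ψ t)) (Icc 0 T) :=
      ⟨_, (ContinuousLinearMap.mul ℝ (E →L[ℝ] E)).lipschitz.comp_lipschitzOnWith hC⟩
    obtain ⟨D, hD⟩ := LipschitzOnWith.clm_apply hl hΦl
    rw [← uIcc_of_le hT] at hD
    have h0 : ∀ᵐ t, t ∈ uIcc 0 T → HasDerivAt
        (fun t => ContinuousLinearMap.mul ℝ (E →L[ℝ] E) (Ψ t) (Φ t)) 0 t := by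
      rw [uIcc_of_le hT, ← ae_restrict_iff' measurableSet_Icc]
      filter_upwards [hΦd, hΨd] with t h1 h2
      have h3 := h2.mul h1
      rw [neg_mul, mul_assoc, neg_add_cancel] at h3
      exact h3
    obtain ⟨c, hc⟩ := hD.absolutelyContinuousOnInterval.const_of_ae_hasDerivAt_zero h0
    rw [uIcc_of_le hT] at hc
    intro t ht
    have h1 := hc t ht
    have h2 := hc 0 ⟨le_rfl, hT⟩
    simp only [ContinuousLinearMap.mul_apply', hΦ0, hΨ0, mul_one] at h1 h2
    rw [h1, h2]
  refine ⟨Φ, Ψ, hΦ, hΨ, hΦl, hΨl, fun t ht => ?_, hΦd, hΨd⟩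
  -- In finite dimension a one-sided inverse is two-sided.
  have h1 : (Ψ t : E →ₗ[ℝ] E) * (Φ t : E →ₗ[ℝ] E) = 1 := by
    ext v; exact congrArg (fun L : E →L[ℝ] E => L v) (hmul t ht)
  have h2 := mul_eq_one_comm.1 h1
  ext v
  exact congrArg (fun L : E →ₗ[ℝ] E => L v) h2

/-- The dynamics `F` is continuous, with jointly continuous differential `DF` in the first two
variables. -/
structure IsC1Dynamics (F : E → V → ℝ → E) (DF : E → V → ℝ → E × V →L[ℝ] E) : Prop where
  continuous : Continuous fun q : E × V × ℝ => F q.1 q.2.1 q.2.2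
  continuous_fderiv : Continuous fun q : E × V × ℝ => DF q.1 q.2.1 q.2.2
  hasFDerivAt : ∀ x u t, HasFDerivAt (fun p : E × V => F p.1 p.2 t) (DF x u t) (x, u)

/-- `x` solves `x' = F (x, u, t)`, `x 0 = x0` on `[0, T]`, in integral form. -/
structure IsIntegralSolution (F : E → V → ℝ → E) (x0 : E) (T : ℝ) (u : ℝ → V) (x : ℝ → E) :
    Prop where
  continuous : Continuous x
  eq_add_integral : ∀ t ∈ Icc 0 T, x t = x0 + ∫ s in (0 : ℝ)..t, F (x s) (u s) s

variable [FiniteDimensional ℝ E] [FiniteDimensional ℝ V] {F : E → V → ℝ → E}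
  {DF : E → V → ℝ → E × V →L[ℝ] E} {x0 : E} {T : ℝ} {u v : ℝ → V} {x y : ℝ → E}

namespace IsC1Dynamics

theorem isLocBdd (hF : IsC1Dynamics F DF) (hx : IsLocBdd x) (hu : IsLocBdd u) :
    IsLocBdd (fun t => F (x t) (u t) t) :=
  have := FiniteDimensional.proper ℝ E
  have := FiniteDimensional.proper ℝ V
  (hx.prodMk (hu.prodMk (IsLocBdd.of_continuous continuous_id))).comp hF.continuous

theorem isLocBdd_fderiv (hF : IsC1Dynamics F DF) (hx : IsLocBdd x) (hu : IsLocBdd u) :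
    IsLocBdd (fun t => DF (x t) (u t) t) :=
  have := FiniteDimensional.proper ℝ E
  have := FiniteDimensional.proper ℝ V
  (hx.prodMk (hu.prodMk (IsLocBdd.of_continuous continuous_id))).comp hF.continuous_fderiv

/-- Mean value inequality on a product of balls, where `DF` is bounded by compactness. -/
theorem exists_lipschitz (hF : IsC1Dynamics F DF) (R M T : ℝ) :
    ∃ L, 0 ≤ L ∧ ∀ t ∈ Icc 0 T, ∀ x x' u u', ‖x‖ ≤ R → ‖x'‖ ≤ R → ‖u‖ ≤ M → ‖u'‖ ≤ M →
      ‖F x u t - F x' u' t‖ ≤ L * (‖x - x'‖ + ‖u - u'‖) := by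
  have := FiniteDimensional.proper ℝ E
  have := FiniteDimensional.proper ℝ V
  obtain ⟨L, hL⟩ := ((isCompact_closedBall (0 : E) R).prod
    ((isCompact_closedBall (0 : V) M).prod (isCompact_Icc (a := 0) (b := T)))).exists_bound_of_continuousOn
    hF.continuous_fderiv.continuousOn
  refine ⟨max L 0, le_max_right _ _, fun t ht x x' u u' hx hx' hu hu' => ?_⟩
  have := Convex.norm_image_sub_le_of_norm_hasFDerivWithin_le (𝕜 := ℝ)
    (f := fun p : E × V => F p.1 p.2 t) (f' := fun p => DF p.1 p.2 t)
    (s := Metric.closedBall (0 : E) R ×ˢ Metric.closedBall (0 : V) M) (C := max L 0)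
    (x := (x', u')) (y := (x, u))
    (fun p _ => (hF.hasFDerivAt p.1 p.2 t).hasFDerivWithinAt)
    (fun p hp => (hL (p.1, p.2, t) ⟨hp.1, hp.2, ht⟩).trans (le_max_left _ _))
    ((convex_closedBall _ _).prod (convex_closedBall _ _))
    (by simp [hx', hu']) (by simp [hx, hu])
  refine this.trans (mul_le_mul_of_nonneg_left ?_ (le_max_right _ _))
  exact max_le (le_add_of_nonneg_right (norm_nonneg _)) (le_add_of_nonneg_left (norm_nonneg _))

theorem eq_of_isIntegralSolution (hF : IsC1Dynamics F DF) (hu : IsLocBdd u)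
    (hx : IsIntegralSolution F x0 T u x) (hy : IsIntegralSolution F x0 T u y) {t : ℝ}
    (ht : t ∈ Icc 0 T) : x t = y t := by
  have hxb := IsLocBdd.of_continuous hx.continuous
  have hyb := IsLocBdd.of_continuous hy.continuous
  obtain ⟨R, hR⟩ := hxb.2 0 T
  obtain ⟨R', hR'⟩ := hyb.2 0 T
  obtain ⟨M, hM⟩ := hu.2 0 T
  obtain ⟨L, hL0, hL⟩ := hF.exists_lipschitz (max R R') M T
  have := norm_le_of_eq_integral (z := fun t => x t - y t)
    (h := fun s => F (x s) (u s) s - F (y s) (u s) s) (hx.continuous.sub hy.continuous)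
    (T := T) hL0 le_rfl (fun t ht => by
      rw [hx.eq_add_integral t ht, hy.eq_add_integral t ht, add_sub_add_left_eq_sub,
        intervalIntegral.integral_sub ((hF.isLocBdd hxb hu).intervalIntegrable _ _)
        ((hF.isLocBdd hyb hu).intervalIntegrable _ _)])
    (fun t ht => by
      simpa using hL t ht _ _ _ _ ((hR t ht).trans (le_max_left _ _))
        ((hR' t ht).trans (le_max_right _ _)) (hM t ht) (hM t ht)) ht
  simpa [sub_eq_zero] using this

/-- `F` is only locally Lipschitz, so solutions are first found globally for `F` composed with a
bounded retraction `ρ`. Grönwall keeps them within `C |s|` of `x`, hence for small `s` where `ρ` is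
the identity, and there they solve the original equation. -/
theorem exists_perturbed_solution (hF : IsC1Dynamics F DF) (hT : 0 ≤ T) (hu : IsLocBdd u)
    (hv : IsLocBdd v) (hx : IsIntegralSolution F x0 T u x) :
    ∃ C, 0 ≤ C ∧ ∃ y : ℝ → ℝ → E, ∀ᶠ s in 𝓝 (0 : ℝ),
      IsIntegralSolution F x0 T (fun t => u t + s • v t) (y s) ∧
      ∀ t ∈ Icc 0 T, ‖y s t - x t‖ ≤ C * |s| := by
  have := FiniteDimensional.complete ℝ E
  have := FiniteDimensional.proper ℝ V
  have hxb := IsLocBdd.of_continuous hx.continuous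
  obtain ⟨R, hR⟩ := hxb.2 0 T
  obtain ⟨M, hM⟩ := hu.2 0 T
  obtain ⟨N, hN⟩ := hv.2 0 T
  have hN0 : 0 ≤ N := (norm_nonneg _).trans (hN 0 ⟨le_rfl, hT⟩)
  obtain ⟨ρ, K, D, hK0, hρl, hρb, hρ⟩ := exists_lipschitz_bounded_retraction E (R + 1)
  obtain ⟨L, hL0, hL⟩ := hF.exists_lipschitz D (M + N) T
  have hρc : Continuous ρ :=
    (LipschitzWith.of_dist_le_mul (K := K.toNNReal) fun y z => by
      rw [dist_eq_norm, dist_eq_norm, Real.coe_toNNReal _ hK0]; exact hρl y z).continuous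
  have hus : ∀ s : ℝ, IsLocBdd (fun t => u t + s • v t) := fun s =>
    (hu.prodMk hv).comp (G := fun p => p.1 + s • p.2) (by fun_prop)
  have husb : ∀ s : ℝ, |s| ≤ 1 → ∀ t ∈ Icc 0 T, ‖u t + s • v t‖ ≤ M + N := by
    intro s hs t ht
    refine (norm_add_le _ _).trans (add_le_add (hM t ht) ?_)
    rw [norm_smul, Real.norm_eq_abs]
    exact (mul_le_of_le_one_left (norm_nonneg _) hs).trans (hN t ht)
  have hex : ∀ s : ℝ, ∃ y : ℝ → E, |s| ≤ 1 → Continuous y ∧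
      ∀ t ∈ Icc 0 T, y t = x0 + ∫ r in (0 : ℝ)..t, F (ρ (y r)) (u r + s • v r) r := by
    intro s
    by_cases hs : |s| ≤ 1
    · obtain ⟨y, hy⟩ := exists_eq_add_integral_of_lipschitz hT (mul_nonneg hL0 hK0)
        (g := fun t y => F (ρ y) (u t + s • v t) t)
        (fun t ht y z => by
          refine (hL t ht _ _ _ _ (hρb y) (hρb z) (husb s hs t ht) (husb s hs t ht)).trans ?_
          rw [sub_self, norm_zero, add_zero, mul_assoc]
          exact mul_le_mul_of_nonneg_left (hρl y z) hL0)
        (fun z hz => hF.isLocBdd (IsLocBdd.of_continuous (hρc.comp hz)) (hus s)) x0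
      exact ⟨y, fun _ => hy⟩
    · exact ⟨0, fun h => absurd h hs⟩
  choose y hy using hex
  -- Grönwall's bound for Lipschitz constant `L * K` and source `L * N * |s|`, with `|s|` taken out.
  set C := L * N * T * Real.exp (L * K * T) with hC
  have hC0 : 0 ≤ C := by positivity
  refine ⟨C, hC0, y, ?_⟩
  -- The second condition confines the perturbed solution to the ball of radius `R + 1`.
  have hev : ∀ᶠ s in 𝓝 (0 : ℝ), |s| < 1 ∧ C * |s| < 1 := by
    have h1 : Tendsto (fun s : ℝ => |s|) (𝓝 0) (𝓝 0) := by
      simpa using (continuous_abs : Continuous fun s : ℝ => |s|).tendsto 0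
    have h2 : Tendsto (fun s : ℝ => C * |s|) (𝓝 0) (𝓝 0) := by
      simpa using h1.const_mul C
    exact (h1.eventually_lt_const one_pos).and (h2.eventually_lt_const one_pos)
  filter_upwards [hev] with s ⟨hs, hCs⟩
  obtain ⟨hyc, hye⟩ := hy s hs.le
  have hρx : ∀ t ∈ Icc 0 T, ρ (x t) = x t := fun t ht => hρ _ ((hR t ht).trans (by linarith))
  have hyρ : IsLocBdd fun r => F (ρ (y s r)) (u r + s • v r) r :=
    hF.isLocBdd (IsLocBdd.of_continuous (hρc.comp hyc)) (hus s)
  have hclose : ∀ t ∈ Icc 0 T, ‖y s t - x t‖ ≤ C * |s| := by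
    intro t ht
    have := norm_le_of_eq_integral (z := fun t => y s t - x t)
      (h := fun r => F (ρ (y s r)) (u r + s • v r) r - F (x r) (u r) r)
      (hyc.sub hx.continuous) (T := T) (mul_nonneg hL0 hK0) (c := L * N * |s|) (by positivity)
      (fun t ht => by
        rw [hye t ht, hx.eq_add_integral t ht, add_sub_add_left_eq_sub,
          intervalIntegral.integral_sub (hyρ.intervalIntegrable _ _)
            ((hF.isLocBdd hxb hu).intervalIntegrable _ _)])
      (fun t ht => by
        have h1 := hL t ht (ρ (y s t)) (ρ (x t)) (u t + s • v t) (u t) (hρb _) (hρb _)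
          (husb s hs.le t ht) ((hM t ht).trans (by linarith))
        rw [hρx t ht] at h1
        refine h1.trans ?_
        have h2 := hρl (y s t) (x t)
        rw [hρx t ht] at h2
        have h3 : ‖u t + s • v t - u t‖ ≤ N * |s| := by
          rw [add_sub_cancel_left, norm_smul, Real.norm_eq_abs, mul_comm]
          exact mul_le_mul_of_nonneg_right (hN t ht) (abs_nonneg s)
        calc _ ≤ L * (K * ‖y s t - x t‖ + N * |s|) := by gcongr
          _ = _ := by ring) ht
    refine this.trans_eq ?_
    rw [hC]; ring
  refine ⟨⟨hyc, fun t ht => ?_⟩, hclose⟩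
  rw [hye t ht]
  congr 1
  refine intervalIntegral.integral_congr fun r hr => ?_
  rw [uIcc_of_le ht.1] at hr
  have hr' : r ∈ Icc 0 T := ⟨hr.1, hr.2.trans ht.2⟩
  have : ‖y s r‖ ≤ R + 1 := by
    have h1 := norm_le_norm_add_norm_sub' (y s r) (x r)
    have h2 := hclose r hr'
    have h3 := hR r hr'
    linarith
  simp only [hρ _ this]

/-- The differential of the end point in the direction `v`, in terms of the resolvent of the
linearized dynamics. -/
theorem exists_solution_tendsto_slope (hF : IsC1Dynamics F DF) (hT : 0 ≤ T) (hu : IsLocBdd u)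
    (hv : IsLocBdd v) (hx : IsIntegralSolution F x0 T u x) {Φ Ψ : ℝ → E →L[ℝ] E}
    (hr : IsResolvent (fun t => (DF (x t) (u t) t).comp (ContinuousLinearMap.inl ℝ E V)) T Φ Ψ) :
    ∃ y : ℝ → ℝ → E,
      (∀ᶠ s in 𝓝 (0 : ℝ), IsIntegralSolution F x0 T (fun t => u t + s • v t) (y s)) ∧
      Tendsto (fun s : ℝ => s⁻¹ • (y s T - x T)) (𝓝[≠] 0)
        (𝓝 (Φ T (∫ t in (0 : ℝ)..T, Ψ t (DF (x t) (u t) t (0, v t))))) := by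
  have := FiniteDimensional.complete ℝ E
  have := FiniteDimensional.proper ℝ E
  have := FiniteDimensional.proper ℝ V
  obtain ⟨C, hC0, y, hy⟩ := hF.exists_perturbed_solution hT hu hv hx
  refine ⟨y, hy.mono fun s hs => hs.1, ?_⟩
  have hxb := IsLocBdd.of_continuous hx.continuous
  have hus : ∀ s : ℝ, IsLocBdd (fun t => u t + s • v t) := fun s =>
    (hu.prodMk hv).comp (G := fun p => p.1 + s • p.2) (by fun_prop)
  have hTT : T ∈ Icc 0 T := ⟨hT, le_rfl⟩
  -- Variation of constants: for `z = y s - x`, this is the a.e. derivative `Ψ (z' - A z)` of `Ψ z`.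
  let k : ℝ → ℝ → E := fun s t => Ψ t (F (y s t) (u t + s • v t) t - F (x t) (u t) t
    - DF (x t) (u t) t (y s t - x t, 0))
  have hDF := hF.isLocBdd_fderiv hxb hu
  have hΨb := IsLocBdd.of_continuous hr.continuous_right
  have hk : ∀ᶠ s in 𝓝 (0 : ℝ), IsLocBdd (k s) ∧
      y s T - x T = Φ T (∫ t in (0 : ℝ)..T, k s t) := by
    filter_upwards [hy] with s ⟨hs, _⟩
    have hyb := IsLocBdd.of_continuous hs.continuous
    have h1 := hF.isLocBdd hyb (hus s)
    have h2 := hF.isLocBdd hxb hu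
    have h3 : IsLocBdd fun t => DF (x t) (u t) t (y s t - x t, 0) :=
      (hDF.prodMk (hyb.prodMk hxb)).comp
        (G := fun p : (E × V →L[ℝ] E) × E × E => p.1 (p.2.1 - p.2.2, 0)) (by fun_prop)
    have hh : IsLocBdd fun t => F (y s t) (u t + s • v t) t - F (x t) (u t) t :=
      (h1.prodMk h2).comp (G := fun p => p.1 - p.2) (by fun_prop)
    have hkb : IsLocBdd (k s) := (hΨb.prodMk (hh.prodMk h3)).comp
      (G := fun p : (E →L[ℝ] E) × E × E => p.1 (p.2.1 - p.2.2)) (by fun_prop)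
    refine ⟨hkb, ?_⟩
    obtain ⟨D, hD⟩ := LipschitzOnWith.clm_apply hr.lipschitz_right (hh.lipschitzOnWith_integral T)
    rw [← uIcc_of_le hT] at hD
    have hz : ∀ t ∈ Icc 0 T, y s t - x t =
        ∫ r in (0 : ℝ)..t, (F (y s r) (u r + s • v r) r - F (x r) (u r) r) := by
      intro t ht
      rw [hs.eq_add_integral t ht, hx.eq_add_integral t ht, add_sub_add_left_eq_sub,
        intervalIntegral.integral_sub (h1.intervalIntegrable _ _) (h2.intervalIntegrable _ _)]
    have := hD.absolutelyContinuousOnInterval.eq_add_integral hkb (by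
      filter_upwards [hr.hasDerivAt_right, hh.ae_hasDerivAt_integral T,
        ae_restrict_mem measurableSet_Icc] with t d1 d2 ht
      have d3 := d1.clm_apply d2
      rw [← hz t ht] at d3
      convert d3 using 1
      rw [neg_apply]
      change Ψ t (_ - DF (x t) (u t) t (y s t - x t, 0)) =
        -Ψ t (DF (x t) (u t) t (y s t - x t, 0)) + _
      rw [map_sub (Ψ t)]
      abel) hTT
    rw [← hz T hTT, intervalIntegral.integral_same, map_zero, zero_add] at this
    rw [← this]
    exact (congrArg (fun L : E →L[ℝ] E => L (y s T - x T)) (hr.left_mul_right T hTT)).symm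
  -- Dominated convergence: both increments are `O(s)` uniformly in `t`, which bounds `s⁻¹ • k s`,
  -- and differentiability of `F` at `(x t, u t)` gives the pointwise limit.
  have hint : Tendsto (fun s : ℝ => ∫ t in (0 : ℝ)..T, s⁻¹ • k s t) (𝓝[≠] 0)
      (𝓝 (∫ t in (0 : ℝ)..T, Ψ t (DF (x t) (u t) t (0, v t)))) := by
    obtain ⟨R, hR⟩ := hxb.2 0 T
    obtain ⟨M, hM⟩ := hu.2 0 T
    obtain ⟨N, hN⟩ := hv.2 0 T
    obtain ⟨P, hP⟩ := hΨb.2 0 T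
    obtain ⟨Q, hQ⟩ := hDF.2 0 T
    have h00 : (0 : ℝ) ∈ Icc 0 T := ⟨le_rfl, hT⟩
    have hN0 : 0 ≤ N := (norm_nonneg _).trans (hN 0 h00)
    have hP0 : 0 ≤ P := (norm_nonneg _).trans (hP 0 h00)
    have hQ0 : 0 ≤ Q := (norm_nonneg _).trans (hQ 0 h00)
    obtain ⟨L, hL0, hL⟩ := hF.exists_lipschitz (R + C) (M + N) T
    have h1 : ∀ᶠ s in 𝓝 (0 : ℝ), |s| < 1 := by
      have h1 : Tendsto (fun s : ℝ => |s|) (𝓝 0) (𝓝 0) := by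
        simpa using (continuous_abs : Continuous fun s : ℝ => |s|).tendsto 0
      exact h1.eventually_lt_const one_pos
    refine intervalIntegral.tendsto_integral_filter_of_dominated_convergence
      (fun _ => P * (L * (C + N) + Q * C)) ?_ ?_ (by simp) ?_
    · filter_upwards [hk.filter_mono nhdsWithin_le_nhds] with s hs
      exact (hs.1.1.const_smul _).aestronglyMeasurable
    · filter_upwards [hy.filter_mono nhdsWithin_le_nhds, h1.filter_mono nhdsWithin_le_nhds,
        self_mem_nhdsWithin] with s hs hs1 hs0
      refine Eventually.of_forall fun t ht => ?_
      rw [uIoc_of_le hT] at ht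
      have ht : t ∈ Icc 0 T := ⟨ht.1.le, ht.2⟩
      have hs0 : 0 < |s| := abs_pos.2 hs0
      have b1 := hs.2 t ht
      have b2 : ‖u t + s • v t - u t‖ ≤ N * |s| := by
        rw [add_sub_cancel_left, norm_smul, Real.norm_eq_abs, mul_comm]
        exact mul_le_mul_of_nonneg_right (hN t ht) (abs_nonneg s)
      have b3 : ‖y s t‖ ≤ R + C := by
        have e1 := norm_le_norm_add_norm_sub' (y s t) (x t)
        have e2 := hR t ht
        have e3 : C * |s| ≤ C := mul_le_of_le_one_right hC0 hs1.le
        linarith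
      have b4 : ‖u t + s • v t‖ ≤ M + N := by
        have e1 := norm_le_norm_add_norm_sub' (u t + s • v t) (u t)
        have e2 := hM t ht
        have e3 : N * |s| ≤ N := mul_le_of_le_one_right hN0 hs1.le
        linarith
      have b5 := hL t ht (y s t) (x t) (u t + s • v t) (u t) b3 ((hR t ht).trans (by linarith))
        b4 ((hM t ht).trans (by linarith))
      have b6 : ‖DF (x t) (u t) t (y s t - x t, 0)‖ ≤ Q * (C * |s|) := by
        refine (ContinuousLinearMap.le_opNorm _ _).trans ?_
        have : ‖((y s t - x t, 0) : E × V)‖ = ‖y s t - x t‖ := by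
          simp [Prod.norm_def]
        rw [this]
        exact mul_le_mul (hQ t ht) b1 (norm_nonneg _) hQ0
      rw [norm_smul, norm_inv, Real.norm_eq_abs, inv_mul_le_iff₀ hs0]
      calc _ ≤ P * (L * (C * |s| + N * |s|) + Q * (C * |s|)) := by
            refine (ContinuousLinearMap.le_opNorm _ _).trans ?_
            refine mul_le_mul (hP t ht) ((norm_sub_le _ _).trans (add_le_add (b5.trans ?_) b6))
              (norm_nonneg _) hP0
            gcongr
        _ = _ := by ring
    · refine Eventually.of_forall fun t ht => ?_
      rw [uIoc_of_le hT] at ht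
      have ht : t ∈ Icc 0 T := ⟨ht.1.le, ht.2⟩
      have hO : (fun s : ℝ => ((y s t, u t + s • v t) : E × V) - (x t, u t)) =O[𝓝 0]
          fun s : ℝ => s := by
        refine Asymptotics.IsBigO.of_bound (C + N) ?_
        filter_upwards [hy] with s hs
        have b1 := hs.2 t ht
        have b2 : ‖u t + s • v t - u t‖ ≤ N * |s| := by
          rw [add_sub_cancel_left, norm_smul, Real.norm_eq_abs, mul_comm]
          exact mul_le_mul_of_nonneg_right (hN t ht) (abs_nonneg s)
        have b3 : 0 ≤ C * |s| := by positivity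
        have b4 : 0 ≤ N * |s| := by positivity
        rw [Prod.mk_sub_mk, Real.norm_eq_abs]
        exact max_le (by linarith) (by linarith)
      have hto : Tendsto (fun s : ℝ => ((y s t, u t + s • v t) : E × V)) (𝓝 0) (𝓝 (x t, u t)) := by
        have := (hO.trans_tendsto tendsto_id).add_const (x t, u t)
        rw [zero_add] at this
        exact this.congr fun s => sub_add_cancel _ _
      have ho := ((hF.hasFDerivAt (x t) (u t) t).isLittleO.comp_tendsto hto).trans_isBigO hO
      have ho' := (ho.mono (nhdsWithin_le_nhds (s := {0}ᶜ))).tendsto_inv_smul_nhds_zero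
      have h5 := (((Ψ t).continuous.tendsto 0).comp ho').add_const (Ψ t (DF (x t) (u t) t (0, v t)))
      rw [map_zero, zero_add] at h5
      refine h5.congr' ?_
      filter_upwards [self_mem_nhdsWithin] with s hs
      have hs : s ≠ 0 := hs
      have e : DF (x t) (u t) t ((y s t, u t + s • v t) - (x t, u t)) =
          DF (x t) (u t) t (y s t - x t, 0) + s • DF (x t) (u t) t (0, v t) := by
        rw [← map_smul, ← map_add]
        simp
      simp only [Function.comp_apply, e, k]
      rw [← map_add (Ψ t), ← map_smul (Ψ t)]
      congr 1
      rw [← sub_sub, smul_sub s⁻¹ _ (s • _), inv_smul_smul₀ hs, sub_add_cancel]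
  have := ((Φ T).continuous.tendsto _).comp hint
  refine this.congr' ?_
  filter_upwards [hk.filter_mono nhdsWithin_le_nhds] with s hs
  rw [hs.2, Function.comp_apply, intervalIntegral.integral_smul, map_smul]

end IsC1Dynamics

end Dynamics

/-! ### The end-point mapping of a control system and its differential. -/

namespace ControlSystem

variable {n m : ℕ} (S : ControlSystem n m)

/-- Projection of `ℝ` onto `[0, T]`. -/
noncomputable def clamp (t : ℝ) : ℝ := projIcc 0 S.T S.T_pos.le t

theorem clamp_mem (t : ℝ) : S.clamp t ∈ Icc 0 S.T := Subtype.coe_prop _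

theorem continuous_clamp : Continuous S.clamp := continuous_subtype_val.comp continuous_projIcc

theorem clamp_of_mem {t : ℝ} (ht : t ∈ Icc 0 S.T) : S.clamp t = t := by
  rw [clamp, projIcc_of_mem _ ht]

/-- The dynamics, frozen in time outside `[0, T]`. -/
noncomputable def clampedDynamics (x : EuclideanSpace ℝ (Fin n)) (u : EuclideanSpace ℝ (Fin m)) (t : ℝ) :
    EuclideanSpace ℝ (Fin n) :=
  S.f x u (S.clamp t)

/-- The differential of the clamped dynamics in the state and the control. -/
noncomputable def clampedFDeriv (x : EuclideanSpace ℝ (Fin n)) (u : EuclideanSpace ℝ (Fin m))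
    (t : ℝ) : EuclideanSpace ℝ (Fin n) × EuclideanSpace ℝ (Fin m) →L[ℝ] EuclideanSpace ℝ (Fin n) :=
  fderiv ℝ (fun p : EuclideanSpace ℝ (Fin n) × EuclideanSpace ℝ (Fin m) =>
    S.f p.1 p.2 (S.clamp t)) (x, u)

theorem isC1Dynamics : IsC1Dynamics S.clampedDynamics S.clampedFDeriv where
  continuous := S.continuousOn_f.comp_continuous
    (f := fun q : EuclideanSpace ℝ (Fin n) × EuclideanSpace ℝ (Fin m) × ℝ =>
      (q.1, q.2.1, S.clamp q.2.2))
    (by have := S.continuous_clamp; fun_prop) fun q => ⟨trivial, trivial, S.clamp_mem _⟩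
  continuous_fderiv := S.continuousOn_fderiv_f.comp_continuous
    (f := fun q : EuclideanSpace ℝ (Fin n) × EuclideanSpace ℝ (Fin m) × ℝ =>
      (q.1, q.2.1, S.clamp q.2.2))
    (by have := S.continuous_clamp; fun_prop) fun q => ⟨trivial, trivial, S.clamp_mem _⟩
  hasFDerivAt x u t := (S.differentiable_f _ (S.clamp_mem t) (x, u)).hasFDerivAt

/-- A class in `L^∞` is bounded only almost everywhere; the representative is set to zero where it
exceeds the norm. -/
theorem exists_isLocBdd_ae_eq (u : S.Control) :
    ∃ v : ℝ → EuclideanSpace ℝ (Fin m), IsLocBdd v ∧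
      v =ᵐ[volume.restrict (Icc (0 : ℝ) S.T)] u := by
  have hm : StronglyMeasurable u := Lp.stronglyMeasurable u
  have hs : MeasurableSet {t | ‖u t‖ ≤ ‖u‖} := hm.norm.measurable measurableSet_Iic
  refine ⟨indicator {t | ‖u t‖ ≤ ‖u‖} u, IsLocBdd.of_bound (hm.indicator hs) (C := ‖u‖) ?_, ?_⟩
  · intro t
    by_cases h : t ∈ {t | ‖u t‖ ≤ ‖u‖}
    · rw [indicator_of_mem h]; exact h
    · rw [indicator_of_notMem h, norm_zero]; exact norm_nonneg _
  · filter_upwards [ae_le_eLpNormEssSup (f := (u : ℝ → EuclideanSpace ℝ (Fin m)))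
      (μ := volume.restrict (Icc (0 : ℝ) S.T))] with t ht
    have ht : ‖u t‖ ≤ ‖u‖ := by
      rw [← eLpNorm_exponent_top] at ht
      rw [Lp.norm_def, ← toReal_enorm]
      exact ENNReal.toReal_mono (Lp.eLpNorm_ne_top u) ht
    exact indicator_of_mem (show t ∈ {t | ‖u t‖ ≤ ‖u‖} from ht) _

variable {S} {u : S.Control} {v : ℝ → EuclideanSpace ℝ (Fin m)}
  {x : ℝ → EuclideanSpace ℝ (Fin n)}

theorem IsTrajectory.continuous_clamp (hx : S.IsTrajectory u x) :
    Continuous fun t => x (S.clamp t) := by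
  have := hx.1.continuousOn
  rw [uIcc_of_le S.T_pos.le] at this
  exact this.comp_continuous S.continuous_clamp S.clamp_mem

/-- A trajectory is arbitrary outside `[0, T]`; composing with `clamp` makes it continuous on `ℝ`.
-/
theorem IsTrajectory.isIntegralSolution (hx : S.IsTrajectory u x) (hv : IsLocBdd v)
    (huv : v =ᵐ[volume.restrict (Icc (0 : ℝ) S.T)] u) :
    IsIntegralSolution S.clampedDynamics S.x0 S.T v fun t => x (S.clamp t) := by
  refine ⟨hx.continuous_clamp, fun t ht => ?_⟩
  rw [← hx.2.1]
  simp only [S.clamp_of_mem ht]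
  refine hx.1.eq_add_integral
    (S.isC1Dynamics.isLocBdd (IsLocBdd.of_continuous hx.continuous_clamp) hv) ?_ ht
  filter_upwards [hx.2.2, huv, ae_restrict_mem measurableSet_Icc] with t h1 h2 h3
  simpa only [clampedDynamics, S.clamp_of_mem h3, h2] using h1

theorem isTrajectory_of_isIntegralSolution (hv : IsLocBdd v)
    (huv : v =ᵐ[volume.restrict (Icc (0 : ℝ) S.T)] u)
    (hx : IsIntegralSolution S.clampedDynamics S.x0 S.T v x) :
    S.IsTrajectory u fun t => S.x0 + ∫ s in (0 : ℝ)..t, S.clampedDynamics (x s) (v s) s := by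
  have hb := S.isC1Dynamics.isLocBdd (IsLocBdd.of_continuous hx.continuous) hv
  refine ⟨?_, by simp, ?_⟩
  · obtain ⟨C, hC⟩ := hb.lipschitzOnWith_integral S.T
    refine LipschitzOnWith.absolutelyContinuousOnInterval (K := C) ?_
    rw [uIcc_of_le S.T_pos.le]
    exact LipschitzOnWith.of_dist_le_mul fun a ha b hb => by simpa using hC.dist_le_mul a ha b hb
  · filter_upwards [hb.ae_hasDerivAt_integral S.T, huv, ae_restrict_mem measurableSet_Icc]
      with t h1 h2 h3
    rw [← hx.eq_add_integral t h3, ← h2]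
    have h4 := h1.const_add S.x0
    simp only [clampedDynamics, S.clamp_of_mem h3] at h4 ⊢
    exact h4

theorem isTrajectory_trajectory (hu : S.IsAdmissible u) : S.IsTrajectory u (S.trajectory u) := by
  rw [trajectory, dif_pos hu]
  exact hu.choose_spec

/-- Uniqueness of integral solutions removes the dependence on the choice made in `trajectory`. -/
theorem endPoint_eq (hv : IsLocBdd v) (huv : v =ᵐ[volume.restrict (Icc (0 : ℝ) S.T)] u)
    (hx : IsIntegralSolution S.clampedDynamics S.x0 S.T v x) : S.endPoint u = x S.T := by
  have hT : S.T ∈ Icc 0 S.T := ⟨S.T_pos.le, le_rfl⟩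
  have := S.isC1Dynamics.eq_of_isIntegralSolution hv
    ((isTrajectory_trajectory ⟨_, isTrajectory_of_isIntegralSolution hv huv hx⟩).isIntegralSolution
      hv huv) hx hT
  rwa [S.clamp_of_mem hT] at this

/-- The differential of the dynamics along the pair `(x_u, v)`. -/
noncomputable def fderivAlong (S : ControlSystem n m) (u : S.Control)
    (v : ℝ → EuclideanSpace ℝ (Fin m)) (t : ℝ) :
    EuclideanSpace ℝ (Fin n) × EuclideanSpace ℝ (Fin m) →L[ℝ] EuclideanSpace ℝ (Fin n) :=
  S.clampedFDeriv (S.trajectory u (S.clamp t)) (v t) t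

theorem isLocBdd_fderivAlong (hu : S.IsAdmissible u) (hv : IsLocBdd v) :
    IsLocBdd (S.fderivAlong u v) :=
  S.isC1Dynamics.isLocBdd_fderiv
    (IsLocBdd.of_continuous (isTrajectory_trajectory hu).continuous_clamp) hv

/-- The integral kernel of the differential of the end-point mapping. -/
noncomputable def kernel (S : ControlSystem n m) (u : S.Control)
    (v : ℝ → EuclideanSpace ℝ (Fin m))
    (Φ Ψ : ℝ → EuclideanSpace ℝ (Fin n) →L[ℝ] EuclideanSpace ℝ (Fin n)) (t : ℝ) :
    EuclideanSpace ℝ (Fin m) →L[ℝ] EuclideanSpace ℝ (Fin n) :=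
  (Φ S.T).comp ((Ψ t).comp ((S.fderivAlong u v t).comp (ContinuousLinearMap.inr ℝ _ _)))

/-- `Φ` is the resolvent of the dynamics linearized along `(x_u, v)`, with inverse `Ψ`. -/
def IsLinearizedResolvent (S : ControlSystem n m) (u : S.Control)
    (v : ℝ → EuclideanSpace ℝ (Fin m))
    (Φ Ψ : ℝ → EuclideanSpace ℝ (Fin n) →L[ℝ] EuclideanSpace ℝ (Fin n)) : Prop :=
  IsResolvent (fun t => (S.fderivAlong u v t).comp (ContinuousLinearMap.inl ℝ _ _)) S.T Φ Ψ

variable {Φ Ψ : ℝ → EuclideanSpace ℝ (Fin n) →L[ℝ] EuclideanSpace ℝ (Fin n)}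

theorem exists_isLinearizedResolvent (hu : S.IsAdmissible u) (hv : IsLocBdd v) :
    ∃ Φ Ψ, S.IsLinearizedResolvent u v Φ Ψ :=
  exists_isResolvent ((isLocBdd_fderivAlong hu hv).comp
    (G := fun L => L.comp (ContinuousLinearMap.inl ℝ _ _)) (by fun_prop)) S.T_pos.le

theorem isLocBdd_kernel (hu : S.IsAdmissible u) (hv : IsLocBdd v)
    (hr : S.IsLinearizedResolvent u v Φ Ψ) : IsLocBdd (S.kernel u v Φ Ψ) :=
  ((IsLocBdd.of_continuous hr.continuous_right).prodMk (isLocBdd_fderivAlong hu hv)).comp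
    (G := fun p => (Φ S.T).comp (p.1.comp (p.2.comp (ContinuousLinearMap.inr ℝ _ _))))
    (by fun_prop)

/-- Integral representation of the differential of the end-point mapping. -/
theorem fderiv_endPoint_apply (hu : S.IsAdmissible u) (hv : IsLocBdd v)
    (huv : v =ᵐ[volume.restrict (Icc (0 : ℝ) S.T)] u)
    (hr : S.IsLinearizedResolvent u v Φ Ψ) {D : S.Control →L[ℝ] EuclideanSpace ℝ (Fin n)}
    (hD : HasFDerivAt S.endPoint D u) (w : S.Control) {w' : ℝ → EuclideanSpace ℝ (Fin m)}
    (hw' : IsLocBdd w') (hw : w' =ᵐ[volume.restrict (Icc (0 : ℝ) S.T)] w) :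
    D w = ∫ t in (0 : ℝ)..S.T, S.kernel u v Φ Ψ t (w' t) := by
  have hx := (isTrajectory_trajectory hu).isIntegralSolution hv huv
  obtain ⟨y, hy, hlim⟩ := S.isC1Dynamics.exists_solution_tendsto_slope S.T_pos.le hv hw' hx hr
  -- Since `D` is given as a Fréchet differential, its value at `w` is identified by the limit of
  -- slopes along one line.
  have hline : HasDerivAt (fun s : ℝ => S.endPoint (u + s • w)) (D w) 0 := by
    have h1 : HasDerivAt (fun s : ℝ => u + s • w) w 0 := by
      simpa using ((hasDerivAt_id (0 : ℝ)).smul_const w).const_add u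
    have h2 : HasFDerivAt S.endPoint D (u + (0 : ℝ) • w) := by simpa using hD
    exact h2.comp_hasDerivAt 0 h1
  have hint : Φ S.T (∫ t in (0 : ℝ)..S.T, Ψ t (S.fderivAlong u v t (0, w' t))) =
      ∫ t in (0 : ℝ)..S.T, S.kernel u v Φ Ψ t (w' t) := by
    rw [← ContinuousLinearMap.intervalIntegral_comp_comm]
    · rfl
    · exact (((IsLocBdd.of_continuous hr.continuous_right).prodMk
        ((isLocBdd_fderivAlong hu hv).prodMk hw')).comp
        (G := fun p => p.1 (p.2.1 (0, p.2.2))) (by fun_prop)).intervalIntegrable _ _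
  rw [← hint]
  refine tendsto_nhds_unique (hline.tendsto_slope.congr' ?_) hlim
  filter_upwards [hy.filter_mono nhdsWithin_le_nhds] with s hs
  have e1 : S.endPoint (u + s • w) = y s S.T := by
    refine endPoint_eq (v := fun t => v t + s • w' t) ((hv.prodMk hw').comp
      (G := fun p => p.1 + s • p.2) (by fun_prop)) ?_ hs
    filter_upwards [huv, hw, Lp.coeFn_add u (s • w), Lp.coeFn_smul s w] with t h1 h2 h3 h4
    rw [h3, Pi.add_apply, h4, Pi.smul_apply, h1, h2]
  have e2 : S.endPoint u = S.trajectory u (S.clamp S.T) := endPoint_eq hv huv hx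
  rw [slope_def_module, sub_zero, zero_smul, add_zero, e1, e2]

/-- By the integral formula `ψ` vanishes on the range of `D`, which is everything. -/
theorem eq_zero_of_comp_kernel_ae_eq_zero (hu : S.IsAdmissible u) (hv : IsLocBdd v)
    (huv : v =ᵐ[volume.restrict (Icc (0 : ℝ) S.T)] u)
    (hr : S.IsLinearizedResolvent u v Φ Ψ) {D : S.Control →L[ℝ] EuclideanSpace ℝ (Fin n)}
    (hD : HasFDerivAt S.endPoint D u) (hsurj : Function.Surjective D)
    {ψ : EuclideanSpace ℝ (Fin n) →L[ℝ] ℝ}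
    (hψ : ∀ᵐ t ∂(volume.restrict (Icc (0 : ℝ) S.T)), ψ.comp (S.kernel u v Φ Ψ t) = 0) :
    ψ = 0 := by
  ext z
  obtain ⟨w, rfl⟩ := hsurj z
  obtain ⟨w', hw', hw⟩ := S.exists_isLocBdd_ae_eq w
  rw [fderiv_endPoint_apply hu hv huv hr hD w hw' hw,
    ← ContinuousLinearMap.intervalIntegral_comp_comm, zero_apply]
  · refine intervalIntegral.integral_zero_ae ?_
    rw [ae_restrict_iff' measurableSet_Icc] at hψ
    filter_upwards [hψ] with t ht h't
    rw [uIoc_of_le S.T_pos.le] at h't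
    exact congrArg (fun L : EuclideanSpace ℝ (Fin m) →L[ℝ] ℝ => L (w' t)) (ht ⟨h't.1.le, h't.2⟩)
  · exact (((isLocBdd_kernel hu hv hr).prodMk hw').comp
      (G := fun p => p.1 p.2) (by fun_prop)).intervalIntegrable _ _

end ControlSystem

/-! ### Comparison of the notions of regularity. -/

namespace ControlSystem

variable {n m : ℕ} {S : ControlSystem n m} {U : Set (EuclideanSpace ℝ (Fin m))} {u : S.Control}
  {v v' : ℝ → EuclideanSpace ℝ (Fin m)}
  {Φ Ψ : ℝ → EuclideanSpace ℝ (Fin n) →L[ℝ] EuclideanSpace ℝ (Fin n)}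

/-- `t ↦ Φ(t) Ψ(τ) w₀` solves the variational equation with value `w₀` at `τ`. The resolvent comes
from `v`, the vectors from another representative `v'`; the two linearized equations agree a.e. -/
theorem resolvent_apply_mem_strongVariationVectors
    (huv : v =ᵐ[volume.restrict (Icc (0 : ℝ) S.T)] u) (hr : S.IsLinearizedResolvent u v Φ Ψ)
    (huv' : v' =ᵐ[volume.restrict (Icc (0 : ℝ) S.T)] u) {τ : ℝ} (hτ : τ ∈ Ico 0 S.T)
    (hL : IsLebesguePoint S.T (fun t => S.f (S.trajectory u t) (v' t) t) τ)
    {ω : EuclideanSpace ℝ (Fin m)} (hω : ω ∈ U) :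
    Φ S.T (Ψ τ (S.f (S.trajectory u τ) ω τ - S.f (S.trajectory u τ) (v' τ) τ)) ∈
      S.strongVariationVectors U (S.trajectory u) v' := by
  have hsub : Icc τ S.T ⊆ Icc 0 S.T := Icc_subset_Icc_left hτ.1
  refine ⟨τ, hτ, hL, ω, hω, fun t => Φ t (Ψ τ (S.f (S.trajectory u τ) ω τ -
    S.f (S.trajectory u τ) (v' τ) τ)), ?_, ?_, ?_, rfl⟩
  · obtain ⟨C, hC⟩ := LipschitzOnWith.clm_apply hr.lipschitz_left
      (z := fun _ => Ψ τ (S.f (S.trajectory u τ) ω τ - S.f (S.trajectory u τ) (v' τ) τ))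
      ⟨0, LipschitzWith.const _ |>.lipschitzOnWith⟩
    refine LipschitzOnWith.absolutelyContinuousOnInterval (K := C) ?_
    rw [uIcc_of_le hτ.2.le]
    exact hC.mono hsub
  · exact congrArg (fun L : EuclideanSpace ℝ (Fin n) →L[ℝ] EuclideanSpace ℝ (Fin n) =>
      L (S.f (S.trajectory u τ) ω τ - S.f (S.trajectory u τ) (v' τ) τ))
      (hr.left_mul_right τ ⟨hτ.1, hτ.2.le⟩)
  · filter_upwards [ae_restrict_of_ae_restrict_of_subset hsub hr.hasDerivAt_left,
      ae_restrict_of_ae_restrict_of_subset hsub huv,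
      ae_restrict_of_ae_restrict_of_subset hsub huv', ae_restrict_mem measurableSet_Icc]
      with t h1 h2 h3 h4
    have ht := hsub h4
    have h5 : HasFDerivAt (fun y => S.f y (v' t) t)
        ((S.fderivAlong u v t).comp (ContinuousLinearMap.inl ℝ _ _)) (S.trajectory u t) := by
      have := (S.isC1Dynamics.hasFDerivAt (S.trajectory u (S.clamp t)) (v t) t).comp
        (S.trajectory u (S.clamp t)) (hasFDerivAt_prodMk_left (𝕜 := ℝ)
          (S.trajectory u (S.clamp t)) (v t))
      rw [h3, ← h2]
      simpa only [clampedDynamics, fderivAlong, S.clamp_of_mem ht] using! this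
    rw [h5.fderiv]
    have h6 := h1.clm_apply (hasDerivAt_const t
      (Ψ τ (S.f (S.trajectory u τ) ω τ - S.f (S.trajectory u τ) (v' τ) τ)))
    rw [map_zero, add_zero] at h6
    exact h6

theorem integrableOn_dynamics (hu : S.IsAdmissible u)
    (huv : v =ᵐ[volume.restrict (Icc (0 : ℝ) S.T)] u) :
    IntegrableOn (fun t => S.f (S.trajectory u t) (v t) t) (Icc 0 S.T) := by
  obtain ⟨w, hw, huw⟩ := S.exists_isLocBdd_ae_eq u
  have hb := S.isC1Dynamics.isLocBdd (IsLocBdd.of_continuous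
    (isTrajectory_trajectory hu).continuous_clamp) hw
  have hi := (intervalIntegrable_iff_integrableOn_Icc_of_le S.T_pos.le).1
    (hb.intervalIntegrable 0 S.T)
  refine hi.congr ?_
  filter_upwards [huv, huw, ae_restrict_mem measurableSet_Icc] with t h1 h2 h3
  simp only [clampedDynamics, S.clamp_of_mem h3, h1, h2]

/-- A pointwise minimum principle followed by Fermat's rule: at almost every `τ` the control value
is an interior minimizer, and the derivative there is `ψ` composed with the kernel. -/
theorem ae_comp_kernel_eq_zero_of_nonneg (hu : S.IsAdmissible u)
    (huU : u ∈ S.controlsIn (interior U))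
    (huv : v =ᵐ[volume.restrict (Icc (0 : ℝ) S.T)] u) (hr : S.IsLinearizedResolvent u v Φ Ψ)
    (huv' : v' =ᵐ[volume.restrict (Icc (0 : ℝ) S.T)] u)
    {ψ : EuclideanSpace ℝ (Fin n) →L[ℝ] ℝ}
    (hψ : ∀ z ∈ S.strongVariationVectors U (S.trajectory u) v', 0 ≤ ψ z) :
    ∀ᵐ t ∂(volume.restrict (Icc (0 : ℝ) S.T)), ψ.comp (S.kernel u v Φ Ψ t) = 0 := by
  have hT : ∀ᵐ t ∂(volume.restrict (Icc (0 : ℝ) S.T)), t ≠ S.T :=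
    ae_restrict_of_ae (by simp [ae_iff, measure_singleton])
  filter_upwards [ae_isLebesguePoint (integrableOn_dynamics hu huv'), huv, huv', huU,
    ae_restrict_mem measurableSet_Icc, hT] with τ hL h1 h2 h3 h4 h5
  have hτ : τ ∈ Ico 0 S.T := ⟨h4.1, lt_of_le_of_ne h4.2 h5⟩
  have hmin : IsLocalMin (fun ω => ψ (Φ S.T (Ψ τ (S.f (S.trajectory u τ) ω τ)))) (v τ) := by
    rw [← h1] at h3
    filter_upwards [mem_interior_iff_mem_nhds.1 h3] with ω hω
    have := hψ _ (resolvent_apply_mem_strongVariationVectors huv hr huv' hτ hL hω)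
    rw [h2, ← h1, map_sub, map_sub, map_sub] at this
    linarith
  have hd := (ψ.hasFDerivAt.comp (v τ) ((Φ S.T).hasFDerivAt.comp (v τ)
    ((Ψ τ).hasFDerivAt.comp (v τ)
    ((S.isC1Dynamics.hasFDerivAt (S.trajectory u (S.clamp τ)) (v τ) τ).comp (v τ)
      (hasFDerivAt_prodMk_right (𝕜 := ℝ) (S.trajectory u (S.clamp τ)) (v τ))))))
  refine hmin.hasFDerivAt_eq_zero ?_
  simpa only [clampedDynamics, kernel, fderivAlong, S.clamp_of_mem h4] using! hd

theorem IsStronglyRegular.isWeaklyURegular (h : S.IsStronglyRegular u) (hu : S.IsAdmissible u)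
    (huU : u ∈ S.controlsIn (interior U)) : S.IsWeaklyURegular U u := by
  obtain ⟨D, hD, hsurj⟩ := h
  intro v' huv'
  by_contra hne
  obtain ⟨ψ, hψ0, hψ⟩ := exists_clm_nonneg_of_pointedCone_ne_univ hne
  obtain ⟨v, hv, huv⟩ := S.exists_isLocBdd_ae_eq u
  obtain ⟨Φ, Ψ, hr⟩ := exists_isLinearizedResolvent hu hv
  exact hψ0 (eq_zero_of_comp_kernel_ae_eq_zero hu hv huv hr hD hsurj
    (ae_comp_kernel_eq_zero_of_nonneg hu huU huv hr huv'
      fun z hz => hψ z (Submodule.subset_span hz)))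

/-- The tangent cone at a control with values in a convex set, as a convex cone. -/
def pointedTangentCone (hU : Convex ℝ U) (huU : u ∈ S.controlsIn U) : PointedCone ℝ S.Control where
  carrier := S.tangentCone U u
  zero_mem' := ⟨0, le_rfl, u, huU, by simp⟩
  smul_mem' := by
    rintro ⟨c, hc⟩ _ ⟨r, hr, w, hw, rfl⟩
    exact ⟨c * r, mul_nonneg hc hr, w, hw, by rw [mul_smul]; rfl⟩
  add_mem' := by
    rintro _ _ ⟨r, hr, w, hw, rfl⟩ ⟨r', hr', w', hw', rfl⟩
    rcases (add_nonneg hr hr').eq_or_lt with h0 | hpos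
    · have e : r = 0 := by linarith
      have e' : r' = 0 := by linarith
      exact ⟨0, le_rfl, u, huU, by simp [e, e']⟩
    -- `r (w - u) + r' (w' - u)` is `r + r'` times the barycenter of `w`, `w'` minus `u`.
    · refine ⟨r + r', hpos.le, (r / (r + r')) • w + (r' / (r + r')) • w', ?_, ?_⟩
      · have hw : ∀ᵐ t ∂(volume.restrict (Icc (0 : ℝ) S.T)), w t ∈ U := hw
        have hw' : ∀ᵐ t ∂(volume.restrict (Icc (0 : ℝ) S.T)), w' t ∈ U := hw'
        change ∀ᵐ t ∂(volume.restrict (Icc (0 : ℝ) S.T)),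
          ((r / (r + r')) • w + (r' / (r + r')) • w') t ∈ U
        filter_upwards [hw, hw', Lp.coeFn_add ((r / (r + r')) • w) ((r' / (r + r')) • w'),
          Lp.coeFn_smul (r / (r + r')) w, Lp.coeFn_smul (r' / (r + r')) w'] with t h1 h2 h3 h4 h5
        rw [h3, Pi.add_apply, h4, h5]
        exact hU h1 h2 (by positivity) (by positivity) (by field_simp)
      · have h1 : (r + r') * (r / (r + r')) = r := by field_simp
        have h2 : (r + r') * (r' / (r + r')) = r' := by field_simp
        rw [smul_sub (r + r'), smul_add, smul_smul, smul_smul, h1, h2, smul_sub, smul_sub, add_smul]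
        abel

/-- A continuous choice of radii of balls contained in `U`, positive on the interior of `U`. -/
theorem exists_continuous_radius {X : Type*} [PseudoMetricSpace X] (U : Set X) :
    ∃ η : X → ℝ, Continuous η ∧ (∀ w, 0 ≤ η w) ∧ (∀ w ∈ interior U, 0 < η w) ∧
      ∀ w w', dist w' w < η w → w' ∈ U := by
  -- The cap at `1` handles `U = univ`, where the distance to the empty complement is infinite.
  have hne : ∀ w, min 1 (Metric.infEDist w Uᶜ) ≠ ⊤ := fun w =>
    ne_top_of_le_ne_top ENNReal.one_ne_top (min_le_left _ _)
  refine ⟨fun w => (min 1 (Metric.infEDist w Uᶜ)).toReal, ?_, fun w => ENNReal.toReal_nonneg,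
    fun w hw => ?_, fun w w' hww' => ?_⟩
  · exact ENNReal.continuousOn_toReal.comp_continuous
      (continuous_const.min Metric.continuous_infEDist) hne
  · refine ENNReal.toReal_pos ?_ (hne w)
    refine (lt_min one_pos (pos_iff_ne_zero.2 fun h => ?_)).ne'
    rw [← Metric.mem_closure_iff_infEDist_zero, closure_compl] at h
    exact h hw
  · by_contra hU
    have h1 : min 1 (Metric.infEDist w Uᶜ) ≤ edist w w' :=
      (min_le_right _ _).trans (Metric.infEDist_le_edist_of_mem hU)
    have h2 := ENNReal.toReal_mono (edist_ne_top _ _) h1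
    rw [← dist_edist, dist_comm] at h2
    exact absurd hww' (not_lt.2 h2)

/-- The control may approach the boundary of `U`, so no uniform ball around it need lie in the
constraint set; a test direction with length adapted to each `t` suffices. -/
theorem IsStronglyRegular.isStronglyURegular (h : S.IsStronglyRegular u) (hu : S.IsAdmissible u)
    (huU : u ∈ S.controlsIn (interior U)) (hU : Convex ℝ U) : S.IsStronglyURegular U u := by
  obtain ⟨D, hD, hsurj⟩ := h
  refine ⟨D, hD, ?_⟩
  have huU' : u ∈ S.controlsIn U := by
    have huU : ∀ᵐ t ∂(volume.restrict (Icc (0 : ℝ) S.T)), u t ∈ interior U := huU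
    exact huU.mono fun t ht => interior_subset ht
  by_contra hne
  have hne' : (PointedCone.map (D : S.Control →ₗ[ℝ] EuclideanSpace ℝ (Fin n))
      (pointedTangentCone hU huU') : Set (EuclideanSpace ℝ (Fin n))) ≠ univ := by
    rw [PointedCone.coe_map]; exact hne
  obtain ⟨ψ, hψ0, hψ⟩ := exists_clm_nonneg_of_pointedCone_ne_univ hne'
  obtain ⟨v, hv, huv⟩ := S.exists_isLocBdd_ae_eq u
  obtain ⟨Φ, Ψ, hr⟩ := exists_isLinearizedResolvent hu hv
  refine hψ0 (eq_zero_of_comp_kernel_ae_eq_zero hu hv huv hr hD hsurj ?_)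
  have hker := isLocBdd_kernel hu hv hr
  have hc : IsLocBdd fun t => ψ.comp (S.kernel u v Φ Ψ t) :=
    hker.comp (G := fun L => ψ.comp L) (by fun_prop)
  obtain ⟨η, hηc, hη0, hηpos, hη⟩ := exists_continuous_radius U
  let e := (InnerProductSpace.toDual ℝ (EuclideanSpace ℝ (Fin m))).symm
  -- Minus the Riesz gradient, scaled so that its length `η ‖p‖ / (1 + ‖p‖)` is below `η` where `η >
  -- 0`, while the scaling stays continuous.
  let G : EuclideanSpace ℝ (Fin m) × (EuclideanSpace ℝ (Fin m) →L[ℝ] ℝ) →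
      EuclideanSpace ℝ (Fin m) := fun p => -((η p.1 / (1 + ‖p.2‖)) • e p.2)
  have hG : Continuous G := by
    have h1 : ∀ p : EuclideanSpace ℝ (Fin m) × (EuclideanSpace ℝ (Fin m) →L[ℝ] ℝ),
      1 + ‖p.2‖ ≠ 0 := fun p => by positivity
    have h2 : Continuous fun p : EuclideanSpace ℝ (Fin m) × (EuclideanSpace ℝ (Fin m) →L[ℝ] ℝ) =>
      e p.2 := e.continuous.comp continuous_snd
    exact (((hηc.comp continuous_fst).div (by fun_prop) h1).smul h2).neg
  have hw : IsLocBdd fun t => G (v t, ψ.comp (S.kernel u v Φ Ψ t)) := (hv.prodMk hc).comp hG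
  obtain ⟨C, hC⟩ := hw.2 0 S.T
  have hmem : MemLp (fun t => G (v t, ψ.comp (S.kernel u v Φ Ψ t))) ∞
      (volume.restrict (Icc (0 : ℝ) S.T)) :=
    memLp_top_of_bound hw.1.aestronglyMeasurable C
      ((ae_restrict_mem measurableSet_Icc).mono fun t ht => hC t ht)
  let w : S.Control := hmem.toLp _
  have hww : (fun t => G (v t, ψ.comp (S.kernel u v Φ Ψ t))) =ᵐ[volume.restrict (Icc (0 : ℝ) S.T)]
    w := hmem.coeFn_toLp.symm
  have hcone : w ∈ S.tangentCone U u := by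
    refine ⟨1, zero_le_one, u + w, ?_, by simp⟩
    have huU : ∀ᵐ t ∂(volume.restrict (Icc (0 : ℝ) S.T)), u t ∈ interior U := huU
    change ∀ᵐ t ∂(volume.restrict (Icc (0 : ℝ) S.T)), (u + w) t ∈ U
    filter_upwards [huU, huv, hww, Lp.coeFn_add u w] with t h1 h2 h3 h4
    rw [h4, Pi.add_apply, ← h3, ← h2]
    rw [← h2] at h1
    refine hη (v t) _ ?_
    rw [dist_eq_norm, add_sub_cancel_left]
    simp only [G]
    have hpos := hηpos _ h1
    rw [norm_neg, norm_smul, LinearIsometryEquiv.norm_map, Real.norm_eq_abs,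
      abs_of_nonneg (by positivity), div_mul_eq_mul_div, div_lt_iff₀ (by positivity)]
    nlinarith
  have hnn : 0 ≤ ψ (D w) := hψ _ ⟨w, hcone, rfl⟩
  have hval : ∀ t, ψ (S.kernel u v Φ Ψ t (G (v t, ψ.comp (S.kernel u v Φ Ψ t)))) =
      -(η (v t) / (1 + ‖ψ.comp (S.kernel u v Φ Ψ t)‖) * ‖ψ.comp (S.kernel u v Φ Ψ t)‖ ^ 2) := by
    intro t
    have h1 : (ψ.comp (S.kernel u v Φ Ψ t)) (e (ψ.comp (S.kernel u v Φ Ψ t))) =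
        ‖ψ.comp (S.kernel u v Φ Ψ t)‖ ^ 2 := by
      rw [← InnerProductSpace.toDual_symm_apply, real_inner_self_eq_norm_sq,
        LinearIsometryEquiv.norm_map]
    rw [← h1]
    simp [G]
  have hsm : IsLocBdd fun t =>
      η (v t) / (1 + ‖ψ.comp (S.kernel u v Φ Ψ t)‖) * ‖ψ.comp (S.kernel u v Φ Ψ t)‖ ^ 2 :=
    (hv.prodMk hc).comp (G := fun p => η p.1 / (1 + ‖p.2‖) * ‖p.2‖ ^ 2) (by
      refine ((hηc.comp continuous_fst).div (by fun_prop) fun p => ?_).mul (by fun_prop)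
      positivity)
  rw [fderiv_endPoint_apply hu hv huv hr hD w hw hww,
    ← ContinuousLinearMap.intervalIntegral_comp_comm _ (((hker.prodMk hw).comp
      (G := fun p => p.1 p.2) (by fun_prop)).intervalIntegrable _ _)] at hnn
  simp only [hval] at hnn
  rw [intervalIntegral.integral_neg, Left.nonneg_neg_iff,
    intervalIntegral.integral_of_le S.T_pos.le, ← integral_Icc_eq_integral_Ioc] at hnn
  have hnonneg : ∀ t, 0 ≤ η (v t) / (1 + ‖ψ.comp (S.kernel u v Φ Ψ t)‖) *
      ‖ψ.comp (S.kernel u v Φ Ψ t)‖ ^ 2 := fun t => by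
    have := hη0 (v t)
    positivity
  -- A nonnegative function with nonpositive integral vanishes a.e.; since `η > 0` along the
  -- control, `ψ` composed with the kernel does too.
  have hzero := (integral_eq_zero_iff_of_nonneg hnonneg
    ((intervalIntegrable_iff_integrableOn_Icc_of_le S.T_pos.le).1
      (hsm.intervalIntegrable 0 S.T))).1 (le_antisymm hnn (integral_nonneg hnonneg))
  have huU : ∀ᵐ t ∂(volume.restrict (Icc (0 : ℝ) S.T)), u t ∈ interior U := huU
  filter_upwards [hzero, huv, huU] with t h1 h2 h3
  rw [← h2] at h3
  have hpos := hηpos _ h3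
  by_contra h4
  have h5 : 0 < ‖ψ.comp (S.kernel u v Φ Ψ t)‖ := norm_pos_iff.2 h4
  have h6 : 0 < η (v t) / (1 + ‖ψ.comp (S.kernel u v Φ Ψ t)‖) *
      ‖ψ.comp (S.kernel u v Φ Ψ t)‖ ^ 2 := by positivity
  exact h6.ne' h1

theorem IsStronglyURegular.isStronglyRegular (h : S.IsStronglyURegular U u) :
    S.IsStronglyRegular u := by
  obtain ⟨D, hD, hsurj⟩ := h
  refine ⟨D, hD, fun z => ?_⟩
  obtain ⟨w, -, hw⟩ := hsurj.symm.subset (mem_univ z)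
  exact ⟨w, hw⟩

end ControlSystem

/-! ### The counterexample to the converse of (i). -/

section Cubic

theorem surjective_norm_sq_smul {X : Type*} [NormedAddCommGroup X] [NormedSpace ℝ X] :
    Function.Surjective fun w : X => ‖w‖ ^ 2 • w := by
  intro y
  rcases eq_or_ne y 0 with rfl | hy
  · exact ⟨0, by simp⟩
  have hy' : 0 < ‖y‖ := norm_pos_iff.2 hy
  obtain ⟨a, ha, ha3⟩ : ∃ a : ℝ, 0 ≤ a ∧ a ^ 3 = ‖y‖ :=
    ⟨‖y‖ ^ ((3 : ℕ) : ℝ)⁻¹, by positivity, Real.rpow_inv_natCast_pow hy'.le (by norm_num)⟩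
  -- The map is radial, so only the norm needs a cube root.
  refine ⟨(a / ‖y‖) • y, ?_⟩
  have h1 : ‖(a / ‖y‖) • y‖ = a := by
    rw [norm_smul, Real.norm_eq_abs, abs_of_nonneg (by positivity), div_mul_cancel₀ _ hy'.ne']
  simp only [h1, smul_smul]
  rw [← mul_div_assoc, ← pow_succ, ha3, div_self hy'.ne', one_smul]

/-- The scalar control system `x' = u ^ 3`. -/
noncomputable def cubicSystem : ControlSystem 1 1 where
  T := 1
  T_pos := one_pos
  -- In dimension one this is the cube of `w`.
  f _ w _ := ‖w‖ ^ 2 • w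
  x0 := 0
  continuousOn_f := by fun_prop
  differentiable_f t _ := by
    have : ContDiff ℝ 1 fun p : EuclideanSpace ℝ (Fin 1) × EuclideanSpace ℝ (Fin 1) =>
      ‖p.2‖ ^ 2 • p.2 := (contDiff_snd.norm_sq ℝ).smul contDiff_snd
    exact this.differentiable one_ne_zero
  continuousOn_fderiv_f := by
    have : ContDiff ℝ 1 fun p : EuclideanSpace ℝ (Fin 1) × EuclideanSpace ℝ (Fin 1) =>
      ‖p.2‖ ^ 2 • p.2 := (contDiff_snd.norm_sq ℝ).smul contDiff_snd
    have h := this.continuous_fderiv one_ne_zero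
    exact (h.comp (g := fun p => fderiv ℝ (fun p : EuclideanSpace ℝ (Fin 1) ×
      EuclideanSpace ℝ (Fin 1) => ‖p.2‖ ^ 2 • p.2) p) (by fun_prop :
      Continuous fun q : EuclideanSpace ℝ (Fin 1) × EuclideanSpace ℝ (Fin 1) × ℝ =>
        (q.1, q.2.1))).continuousOn

namespace cubicSystem

theorem zero_ae_eq : (fun _ => 0 : ℝ → EuclideanSpace ℝ (Fin 1))
    =ᵐ[volume.restrict (Icc (0 : ℝ) cubicSystem.T)] (0 : cubicSystem.Control) :=
  (Lp.coeFn_zero _ _ _).symm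

theorem isAdmissible_zero : cubicSystem.IsAdmissible 0 :=
  ⟨_, ControlSystem.isTrajectory_of_isIntegralSolution (x := fun _ => 0)
    (IsLocBdd.of_continuous continuous_const) zero_ae_eq
    ⟨continuous_const, fun t _ => by simp [ControlSystem.clampedDynamics, cubicSystem]⟩⟩

/-- The cube has zero derivative at `0`, so the kernel vanishes and the coordinate functional would
have to be zero. -/
theorem not_isStronglyRegular_zero : ¬ cubicSystem.IsStronglyRegular 0 := by
  rintro ⟨D, hD, hsurj⟩
  have hv : IsLocBdd (fun _ => 0 : ℝ → EuclideanSpace ℝ (Fin 1)) :=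
    IsLocBdd.of_continuous continuous_const
  obtain ⟨Φ, Ψ, hr⟩ := ControlSystem.exists_isLinearizedResolvent isAdmissible_zero hv
  have hd : ∀ t, cubicSystem.fderivAlong 0 (fun _ => 0) t = 0 := by
    intro t
    have h1 : HasFDerivAt (fun p : EuclideanSpace ℝ (Fin 1) × EuclideanSpace ℝ (Fin 1) => ‖p.2‖ ^ 2)
        (0 : EuclideanSpace ℝ (Fin 1) × EuclideanSpace ℝ (Fin 1) →L[ℝ] ℝ)
        (cubicSystem.trajectory 0 (cubicSystem.clamp t), 0) := by
      have := (hasFDerivAt_snd (𝕜 := ℝ)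
        (p := (cubicSystem.trajectory 0 (cubicSystem.clamp t),
          (0 : EuclideanSpace ℝ (Fin 1))))).norm_sq
      simpa using this
    have h2 := h1.smul (hasFDerivAt_snd (𝕜 := ℝ)
        (p := (cubicSystem.trajectory 0 (cubicSystem.clamp t), (0 : EuclideanSpace ℝ (Fin 1)))))
    refine (HasFDerivAt.fderiv h2).trans ?_
    simp
  have hψ : (EuclideanSpace.proj (0 : Fin 1) : EuclideanSpace ℝ (Fin 1) →L[ℝ] ℝ) = 0 :=
    ControlSystem.eq_zero_of_comp_kernel_ae_eq_zero isAdmissible_zero hv zero_ae_eq hr hD hsurj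
      (Eventually.of_forall fun t => by simp [ControlSystem.kernel, hd])
  have := congrArg (fun L : EuclideanSpace ℝ (Fin 1) →L[ℝ] ℝ =>
    L (EuclideanSpace.single (0 : Fin 1) (1 : ℝ))) hψ
  simp at this

/-- The dynamics ignores the state, so variation vectors are transported unchanged and a single
Lebesgue point already yields all of `ℝ¹`. -/
theorem isWeaklyURegular_zero : cubicSystem.IsWeaklyURegular univ 0 := by
  intro v hv
  have hae := ae_isLebesguePoint (ControlSystem.integrableOn_dynamics isAdmissible_zero hv)
  have hT : ∀ᵐ t ∂(volume.restrict (Icc (0 : ℝ) cubicSystem.T)), t ≠ cubicSystem.T :=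
    ae_restrict_of_ae (by simp [ae_iff, measure_singleton])
  have hne : NeBot (ae (volume.restrict (Icc (0 : ℝ) cubicSystem.T))) := by
    rw [ae_neBot, Ne, Measure.restrict_eq_zero]
    simp [cubicSystem]
  obtain ⟨τ, ⟨hL, hτ⟩, hτT⟩ := ((hae.and (ae_restrict_mem measurableSet_Icc)).and hT).exists
  refine eq_univ_of_forall fun z => Submodule.subset_span ?_
  -- The representative `v` may be nonzero at `τ`; the shift compensates for its value.
  obtain ⟨ω, hω⟩ := surjective_norm_sq_smul (z + ‖v τ‖ ^ 2 • v τ)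
  refine ⟨τ, ⟨hτ.1, lt_of_le_of_ne hτ.2 hτT⟩, hL, ω, mem_univ _, fun _ => z, ?_, ?_, ?_, rfl⟩
  · exact ((LipschitzWith.const z).lipschitzOnWith).absolutelyContinuousOnInterval
  · exact eq_sub_of_add_eq hω.symm
  · refine Eventually.of_forall fun t => ?_
    have : fderiv ℝ (fun y => cubicSystem.f y (v t) t) (cubicSystem.trajectory 0 t) = 0 :=
      fderiv_const_apply _
    rw [this, zero_apply]
    exact hasDerivAt_const t z

end cubicSystem

end Cubic

/-! ### The full statement. -/

theorem proposition7 :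
    (∀ (n m : ℕ), 0 < n → 0 < m → ∀ (S : ControlSystem n m)
      (U : Set (EuclideanSpace ℝ (Fin m))) (u : S.Control),
      S.IsAdmissible u → u ∈ S.controlsIn (interior U) →
        (S.IsStronglyRegular u → S.IsWeaklyURegular U u) ∧
        (Convex ℝ U → (S.IsStronglyRegular u ↔ S.IsStronglyURegular U u))) ∧
    (∃ (n m : ℕ), 0 < n ∧ 0 < m ∧ ∃ (S : ControlSystem n m)
      (U : Set (EuclideanSpace ℝ (Fin m))) (u : S.Control),
      S.IsAdmissible u ∧ u ∈ S.controlsIn (interior U) ∧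
        S.IsWeaklyURegular U u ∧ ¬ S.IsStronglyRegular u) := by
  refine ⟨fun n m _ _ S U u hu huU => ⟨fun h => h.isWeaklyURegular hu huU, fun hU =>
    ⟨fun h => h.isStronglyURegular hu huU hU, fun h => h.isStronglyRegular⟩⟩, 1, 1, one_pos,
    one_pos, cubicSystem, univ, 0, cubicSystem.isAdmissible_zero, ?_,
    cubicSystem.isWeaklyURegular_zero, cubicSystem.not_isStronglyRegular_zero⟩
  rw [interior_univ]
  simp [ControlSystem.controlsIn]
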